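/- Let $E$ be a finite set. A bouquet of matroids $\mathcal M$ on $E$ consists of a nonempty clutter of subsets $E_1,\dots,E_n$ of $E$ (the roofs; no roof contains another) and a family $\mathcal I$ of subsets of $E$ such that (i) for each $i$, $\mathcal I_i=\mathcal I\cap 2^{E_i}$ is the family of independent sets of a matroid $M_i$ on $E_i$; (ii) $\mathcal I=\bigcup_i\mathcal I_i$; (iii) if $I\in\mathcal I_i\cap\mathcal I_j$ and $e\in E_i\setminus E_j$, then $I\cup\{e\}\in\mathcal I$. Its flats are the flats of the matroids $M_i$; ordered by inclusion they form a finite poset $P$ with least element $\hat 0$. Work in the polynomial ring $\mathbb Z[w_e : e\in E]$, with the convention that $w_e$ is replaced by $0$ if $e$ is a loop (an element of a roof with $\{e\}\notin\mathcal I$), and put $w(K)=\sum_{e\in K}w_e$ for every flat $K$. Fix any labeling $l$ that assigns to each $x\in P\setminus\{\hat 0\}$ an atom $l(x)\le x$ of $P$. A neat chain is a maximal chain $\hat 0=x_0\lessdot x_1\lessdot\dots\lessdot x_k$ of $P$ ($x_k$ maximal in $P$), written $C=[x_1\lessdot\dots\lessdot x_k]$ and of size $|C|=k$, such that $l(x_i)\not\le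 x_{i-1}$ for all $i=1,\dots,k$. A tuple $(a_1,\dots,a_k)$ of atoms generates $C$, written $ch(a_1,\dots,a_k)=C$, if $x_i=a_1\vee\dots\vee a_i$ for all $i=1,\dots,k$. The flag matrix $\mathfrak F$ of $\mathcal M$ is the square matrix indexed by the neat chains with $$\mathfrak F_{C,C'}=\sum \operatorname{sgn}(\sigma)\,w(a_1)\cdots w(a_k),$$ where the sum is over all tuples $(a_1,\dots,a_k)$ of atoms and all permutations $\sigma$ of $\{1,\dots,k\}$ with $ch(a_1,\dots,a_k)=C$ and $ch(a_{\sigma(1)},\dots,a_{\sigma(k)})=C'$ if $k=|C|=|C'|$, and $\mathfrak F_{C,C'}=0$ if $|C|\ne|C'|$. Let $\mu$ be the Möbius function of $P$ and $r(x)$ the length of a longest chain from $\hat 0$ to $x$. Put $\beta(x)=(-1)^{r(x)}\sum_{y\le x}\mu(\hat 0,y)\,r(y)$ and $\rho(x)=\beta(x)\sum_{m}|\mu(x,m)|$, where $m$ runs over the maximal elements of $P$ with $x\le m$. Then $\rho(K)\ge 0$ for every flat $K$, and $$\det(\mathfrak F)=\pm\prod_{K\text{ flat of }\mathcal M} w(K)^{\rho(K)}.$$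 -/

import Mathlib

/-! ### Combinatorics of a finite poset with least element `⊥` -/

section PosetInvariants

variable {P : Type*} [PartialOrder P] [OrderBot P] [Fintype P]

open Classical in
/-- The Möbius function `μ(x, y)` of a finite poset (Mathlib's, with integer values). -/
noncomputable def moebius (x y : P) : ℤ :=
  letI : LocallyFiniteOrder P := Fintype.toLocallyFiniteOrder
  IncidenceAlgebra.mu ℤ x y

/-- The rank `r(x)`: the length of a longest chain from `⊥` to `x`. (In a bouquet of geometric
lattices all unrefinable chains from `⊥` to `x` have this length.) -/
noncomputable def rk (x : P) : ℕ := (Order.height x).toNat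

open Classical in
/-- Crapo's beta function `β(x) = (-1)^{r(x)} ∑_{y ≤ x} μ(⊥, y) r(y)`. -/
noncomputable def crapoBeta (x : P) : ℤ :=
  (-1) ^ rk x * ∑ y : P with y ≤ x, moebius ⊥ y * (rk y : ℤ)

open Classical in
/-- The cumulated rho function: `ρ(x) = β(x) ∑ |μ(x, m)|`, the sum being over all maximal
elements `m` of `P` that lie above `x`. -/
noncomputable def cumulatedRho (x : P) : ℤ :=
  crapoBeta x * ∑ m : P with IsMax m ∧ x ≤ m, |moebius x m|

end PosetInvariants

/-! ### The chain matrix -/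

section ChainMatrix

variable {P : Type*} [PartialOrder P] [OrderBot P]

/-- A labeling assigns to every element `x ≠ ⊥` an atom below `x`. (The value at `⊥` is never
used.) -/
def IsAtomLabeling (l : P → P) : Prop :=
  ∀ x : P, x ≠ ⊥ → IsAtom (l x) ∧ l x ≤ x

/-- A maximal chain `⊥ = x₀ ⋖ x₁ ⋖ ⋯ ⋖ x_k` of `P` with `x_k` maximal in `P`, which is neat for
the labeling `l`: one has `l(x_i) ≰ x_{i-1}` for `i = 1, …, k`. Its size is `k` (that is, `⊥` is
not counted). -/
structure NeatChain (l : P → P) where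
  /-- the sequence `x₀ ⋖ x₁ ⋖ ⋯ ⋖ x_k` -/
  series : RelSeries {p : P × P | p.1 ⋖ p.2}
  head_eq : series.head = ⊥
  isMax_last : IsMax series.last
  neat : ∀ i : Fin series.length, ¬ l (series i.succ) ≤ series i.castSucc

/-- The size `k` of the chain `x₁ ⋖ ⋯ ⋖ x_k`. -/
def NeatChain.size {l : P → P} (C : NeatChain l) : ℕ := C.series.length

/-- The tuple `(a₁, …, a_k)` of atoms generates the chain `C = [x₁ ⋖ ⋯ ⋖ x_n]`: one has `k = n`
and `x_i = a₁ ∨ ⋯ ∨ a_i` for `i = 1, …, k`. The index `i : Fin k` stands for `i + 1`. -/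
def Generates {l : P → P} {k : ℕ} (a : Fin k → {x : P // IsAtom x}) (C : NeatChain l) : Prop :=
  ∃ h : k = C.size, ∀ i : Fin k,
    IsLUB ((fun j => (a j : P)) '' Set.Iic i) (C.series (Fin.cast h i).succ)

theorem NeatChain.finite [Finite P] (l : P → P) : Finite (NeatChain l) := by
  classical
  have := Fintype.ofFinite P
  have hnodup : ∀ C : NeatChain l, C.series.toList.Nodup := by
    intro C
    have h : C.series.toList.IsChain (· < ·) :=
      C.series.isChain_toList.imp fun _ _ h => CovBy.lt h
    exact (List.isChain_iff_pairwise.1 h).imp fun h => h.ne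
  refine Finite.of_injective
    (fun C : NeatChain l => (⟨C.series.toList, hnodup C⟩ : {L : List P // L.Nodup})) ?_
  rintro ⟨s, _, _, _⟩ ⟨t, _, _, _⟩ h
  have hst : s = t := RelSeries.toList_injective (congrArg Subtype.val h)
  subst hst
  rfl

noncomputable instance NeatChain.instFintype [Finite P] (l : P → P) : Fintype (NeatChain l) :=
  haveI := NeatChain.finite l
  Fintype.ofFinite _

noncomputable instance NeatChain.instDecidableEq (l : P → P) : DecidableEq (NeatChain l) :=
  Classical.decEq _

open Classical in
/-- The chain matrix of `P` with respect to the labeling `l` and atom weights `w`. The entry at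
`(C, C')` is the sum of `sgn(σ) w(a₁) ⋯ w(a_k)` over all tuples `(a₁, …, a_k)` of atoms generating
`C` and all permutations `σ` such that the permuted tuple `(a_{σ(1)}, …, a_{σ(k)})` generates
`C'`; here `k` is the size of `C`, and the sum is empty if `C'` has another size. -/
noncomputable def chainMatrix [Fintype P] {A : Type*} [CommRing A] (l : P → P) (w : P → A) :
    Matrix (NeatChain l) (NeatChain l) A :=
  Matrix.of fun C C' =>
    ∑ a : Fin C.size → {x : P // IsAtom x}, ∑ σ : Equiv.Perm (Fin C.size),
      if Generates a C ∧ Generates (a ∘ σ) C' then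
        ((Equiv.Perm.sign σ : ℤ) : A) * ∏ i, w (a i)
      else 0

end ChainMatrix

/-! ### Bouquets of matroids -/

/-- A bouquet of matroids on `E`, given by its roofs and its independent sets. -/
structure MatroidBouquet (E : Type*) where
  /-- the roofs `E₁, …, E_n` -/
  roofs : Set (Set E)
  /-- the family of independent sets -/
  indep : Set (Set E)
  roofs_nonempty : roofs.Nonempty
  /-- the roofs form a clutter -/
  clutter : IsAntichain (· ⊆ ·) roofs
  /-- the independent sets inside a roof `R` are those of a matroid on `R` -/
  exists_matroid : ∀ R ∈ roofs, ∃ M : Matroid E, M.E = R ∧ ∀ I, M.Indep I ↔ I ∈ indep ∧ I ⊆ R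
  /-- every independent set lies in some roof -/
  indep_subset_roof : ∀ I ∈ indep, ∃ R ∈ roofs, I ⊆ R
  insert_mem : ∀ R ∈ roofs, ∀ S ∈ roofs, ∀ I ∈ indep, I ⊆ R → I ⊆ S →
    ∀ e ∈ R \ S, insert e I ∈ indep

namespace MatroidBouquet

variable {E : Type*} (𝓜 : MatroidBouquet E)

/-- `M` is one of the matroids of the bouquet: its ground set is a roof and its independent sets
are the independent sets of the bouquet inside this roof. -/
def IsMember (M : Matroid E) : Prop :=
  M.E ∈ 𝓜.roofs ∧ ∀ I, M.Indep I ↔ I ∈ 𝓜.indep ∧ I ⊆ M.E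

/-- The flats of a bouquet are the flats of its matroids. -/
def IsFlat (K : Set E) : Prop := ∃ M : Matroid E, 𝓜.IsMember M ∧ M.IsFlat K

/-- The set of flats. -/
def Flat : Type _ := {K : Set E // 𝓜.IsFlat K}

/-- The flats are ordered by inclusion. -/
instance : PartialOrder 𝓜.Flat := inferInstanceAs (PartialOrder {K : Set E // 𝓜.IsFlat K})

noncomputable instance [Finite E] : Fintype 𝓜.Flat :=
  haveI : Finite 𝓜.Flat := inferInstanceAs (Finite {K : Set E // 𝓜.IsFlat K})
  Fintype.ofFinite _

theorem exists_isMember : ∃ M : Matroid E, 𝓜.IsMember M := by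
  obtain ⟨R, hR⟩ := 𝓜.roofs_nonempty
  obtain ⟨M, hE, hM⟩ := 𝓜.exists_matroid R hR
  subst hE
  exact ⟨M, hR, hM⟩

theorem loops_subset_loops {M N : Matroid E} (hM : 𝓜.IsMember M) (hN : 𝓜.IsMember N) :
    M.loops ⊆ N.loops := by
  intro e he
  have heM : e ∈ M.E := M.loops_subset_ground he
  have hdep : {e} ∉ 𝓜.indep := fun h =>
    (Matroid.isLoop_iff.2 he).not_isNonloop
      (Matroid.indep_singleton.1 ((hM.2 _).2 ⟨h, Set.singleton_subset_iff.2 heM⟩))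
  have h0 : ∅ ∈ 𝓜.indep := ((hM.2 ∅).1 M.empty_indep).1
  have heN : e ∈ N.E := by
    by_contra heN
    exact hdep (by
      simpa using 𝓜.insert_mem _ hM.1 _ hN.1 ∅ h0 (Set.empty_subset _) (Set.empty_subset _) e
        ⟨heM, heN⟩)
  by_contra hl
  have hnl : N.IsNonloop e := (Matroid.not_isLoop_iff heN).1 hl
  exact hdep ((hN.2 _).1 (Matroid.indep_singleton.2 hnl)).1

/-- The least flat is the set of loops, which is the same for all matroids of the bouquet. -/
noncomputable instance : OrderBot 𝓜.Flat where
  bot := ⟨𝓜.exists_isMember.choose.loops,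
    𝓜.exists_isMember.choose, 𝓜.exists_isMember.choose_spec, Matroid.isFlat_closure _⟩
  bot_le := by
    rintro ⟨K, N, hN, hK⟩
    exact (𝓜.loops_subset_loops 𝓜.exists_isMember.choose_spec hN).trans hK.loops_subset

open Classical in
/-- The weight of `e ∈ E`: an indeterminate `w_e`, except that loops (the elements `e` of roofs
with `{e}` not independent) have weight `0`. Elements outside all roofs play no role. -/
noncomputable def elementWeight (e : E) : MvPolynomial E ℤ :=
  if {e} ∈ 𝓜.indep then MvPolynomial.X e else 0

variable [Fintype E]

open Classical in
/-- The weight `w(K) = ∑_{e ∈ K} w_e` of a flat `K`. -/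
noncomputable def weight (K : 𝓜.Flat) : MvPolynomial E ℤ :=
  ∑ e : E with e ∈ K.1, 𝓜.elementWeight e

/-- The flag matrix of a bouquet of matroids: the chain matrix of its poset of flats. -/
noncomputable def flagMatrix (l : 𝓜.Flat → 𝓜.Flat) :
    Matrix (NeatChain l) (NeatChain l) (MvPolynomial E ℤ) :=
  chainMatrix l 𝓜.weight

end MatroidBouquet

/-! Send a chain `x₁ ⋖ ⋯ ⋖ x_k` to the product `x_k ∧ ⋯ ∧ x₁` of the indicator vectors of the sets
of atoms below the `x_i`. With the form `diag(w)` extended to the exterior algebra, the flag matrix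
is the Gram matrix of the neat chains (`chainMatrix_apply`): the differences `x_i - x_{i-1}` are
supported on the atoms allowed at step `i` of a generating tuple. Chains with different tops are
orthogonal, so the determinant is the product over maximal `m` of the Gram determinants `D(m)` of
the neat chains with top `m`.

`D(x)` is computed for every `x`. The neat chains with top `x` span all flags with top `x`, and
there are `|μ(⊥, x)|` of them. Fix an atom `e ≤ x` and let `Z_p` be the Gram determinant of the
products `x ∧ c`, where `c` is a neat chain of length `p - 1` in `[⊥, x]` with top not above `e`.
Contraction by `x` undoes multiplication by `x` up to the factor `w(x)`; this gives `Z_p Z_{p+1} =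
w(x)^n ∏_{r(y)=p} D(y)`, with `n` the number of chains in `Z_{p+1}` (`gramDet_coneFam_mul`). For `e
= l(x)` one has `Z_0 = 1` and `Z_{r(x)} = D(x)`. Solving the recursion, Crapo's formula turns the
exponent of `w(x)` into `β(x)`, and induction over `y < x` yields `D(x) = ∏_u w(u)^{β(u)|μ(u,x)|}`
(`neatDet_eq_prod`). The product over maximal elements has exponents `ρ`.

The same formula with integer weights, chosen so that a prime divides `w(x)` exactly once and no
`w(y)` with `⊥ < y < x`, exhibits `β(x)` as a valuation of an integer, hence `β(x) ≥ 0`. -/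

set_option linter.unusedSectionVars false

open Finset ExteriorAlgebra

/-! ### Bouquets of geometric lattices and their Möbius functions. -/

/-- A finite poset all of whose lower intervals are geometric lattices, and in which any two
elements have a meet. -/
class GeometricBouquet (P : Type*) [PartialOrder P] [OrderBot P] : Prop where
  exists_isGLB : ∀ x y : P, ∃ m, IsGLB {x, y} m
  rk_covBy : ∀ {x y : P}, x ⋖ y → rk y = rk x + 1
  exists_cover : ∀ {e x y : P}, IsAtom e → e ≤ x → y ≤ x → ¬ e ≤ y → ∃ z, y ⋖ z ∧ z ≤ x ∧ e ≤ z
  exists_atom : ∀ {x y : P}, y < x → ∃ e, IsAtom e ∧ e ≤ x ∧ ¬ e ≤ y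

namespace GeometricBouquet

variable {P : Type*} [PartialOrder P] [OrderBot P] [Fintype P]

theorem rk_bot : rk (⊥ : P) = 0 := by simp [rk]

theorem height_lt_top (x : P) : Order.height x < ⊤ :=
  lt_of_le_of_lt (Order.height_le (n := (Fintype.card P : ℕ∞)) fun p _ =>
    by exact_mod_cast p.length_lt_card.le) (ENat.natCast_lt_top _)

theorem coe_rk (x : P) : (rk x : ℕ∞) = Order.height x := ENat.natCast_toNat (height_lt_top x).ne

theorem rk_lt {x y : P} (h : x < y) : rk x < rk y := by
  have := Order.height_strictMono h (height_lt_top x)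
  rw [← coe_rk, ← coe_rk] at this
  exact_mod_cast this

theorem covBy_of_rk {x y : P} (h : x ≤ y) (hr : rk y = rk x + 1) : x ⋖ y := by
  refine ⟨lt_of_le_of_ne h (by rintro rfl; omega), fun z h1 h2 => ?_⟩
  have := rk_lt h1
  have := rk_lt h2
  omega

open Classical in
theorem sum_moebius (u x : P) :
    ∑ y : P with u ≤ y ∧ y ≤ x, moebius u y = if u = x then 1 else 0 := by
  let _ : DecidableLT P := Classical.decRel _
  let _ : DecidableLE P := Classical.decRel _
  let _ : DecidableEq P := Classical.decEq _
  let _ : LocallyFiniteOrder P := Fintype.toLocallyFiniteOrder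
  rw [← IncidenceAlgebra.sum_Icc_mu_right (𝕜 := ℤ) u x]
  refine Finset.sum_congr ?_ fun y _ => rfl
  ext y
  simp

theorem moebius_self (x : P) : moebius x x = 1 := by
  let _ : DecidableLT P := Classical.decRel _
  let _ : DecidableLE P := Classical.decRel _
  let _ : DecidableEq P := Classical.decEq _
  let _ : LocallyFiniteOrder P := Fintype.toLocallyFiniteOrder
  exact IncidenceAlgebra.mu_self x

theorem exists_covBy_le {u x : P} (h : u < x) : ∃ a, u ⋖ a ∧ a ≤ x := by
  let _ : DecidableLT P := Classical.decRel _
  let _ : DecidableLE P := Classical.decRel _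
  let _ : DecidableEq P := Classical.decEq _
  let _ : LocallyFiniteOrder P := Fintype.toLocallyFiniteOrder
  classical
  exact exists_covBy_le_of_lt h

theorem exists_le_covBy {u x : P} (h : u < x) : ∃ a, u ≤ a ∧ a ⋖ x := by
  let _ : DecidableLT P := Classical.decRel _
  let _ : DecidableLE P := Classical.decRel _
  let _ : DecidableEq P := Classical.decEq _
  let _ : LocallyFiniteOrder P := Fintype.toLocallyFiniteOrder
  classical
  exact exists_le_covBy_of_lt h

variable [GeometricBouquet P]

/-- The meet of `z` and `t` lies in `[y, z]` and above `e`, so it is `z`. This is how `z` acts as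
the join of `y` and `e` although joins need not exist. -/
theorem cover_le {y z t e : P} (h : y ⋖ z) (he : ¬ e ≤ y) (hez : e ≤ z) (hyt : y ≤ t)
    (het : e ≤ t) : z ≤ t := by
  obtain ⟨m, hm⟩ := exists_isGLB z t
  have h1 : y ≤ m := hm.2 (by rintro _ (rfl | rfl); exacts [h.le, hyt])
  have h2 : e ≤ m := hm.2 (by rintro _ (rfl | rfl); exacts [hez, het])
  have h3 : m ≤ z := hm.1 (by simp)
  have h4 : m ≤ t := hm.1 (by simp)
  rcases h.eq_or_eq h1 h3 with rfl | rfl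
  · exact absurd h2 he
  · exact h4

theorem cover_unique {y z z' e : P} (he : ¬ e ≤ y) (h : y ⋖ z) (hez : e ≤ z) (h' : y ⋖ z')
    (hez' : e ≤ z') : z = z' :=
  le_antisymm (cover_le h he hez h'.le hez') (cover_le h' he hez' h.le hez)

theorem exists_cover_of_covBy {u a x y : P} (hua : u ⋖ a) (hax : a ≤ x) (huy : u ≤ y)
    (hyx : y ≤ x) (hay : ¬ a ≤ y) : ∃ z, y ⋖ z ∧ z ≤ x ∧ a ≤ z := by
  obtain ⟨e, he, hea, heu⟩ := exists_atom hua.lt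
  have hey : ¬ e ≤ y := fun h => hay (cover_le hua heu hea huy h)
  obtain ⟨z, h1, h2, h3⟩ := exists_cover he (hea.trans hax) hyx hey
  exact ⟨z, h1, h2, cover_le hua heu hea (huy.trans h1.le) h3⟩

open Classical in
/-- Summation over the elements of `[u, x]` that do not lie above `a`, sorted according to
their join with `a`. -/
theorem sum_cover {A : Type*} [AddCommMonoid A] {u a x : P} (hua : u ⋖ a) (hax : a ≤ x)
    (f : P → A) :
    ∑ z : P with a ≤ z ∧ z ≤ x, ∑ h : P with u ≤ h ∧ h ⋖ z ∧ ¬ a ≤ h, f h =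
      ∑ h : P with u ≤ h ∧ h ≤ x ∧ ¬ a ≤ h, f h := by
  rw [Finset.sum_comm' (t' := univ.filter fun h => u ≤ h ∧ h ≤ x ∧ ¬ a ≤ h)
    (s' := fun h => univ.filter fun z => h ⋖ z ∧ z ≤ x ∧ a ≤ z)]
  · refine sum_congr rfl fun h hh => ?_
    simp only [mem_filter, mem_univ, true_and] at hh
    obtain ⟨z, h1, h2, h3⟩ := exists_cover_of_covBy hua hax hh.1 hh.2.1 hh.2.2
    have : (univ.filter fun z => h ⋖ z ∧ z ≤ x ∧ a ≤ z) = {z} := by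
      ext t
      simp only [mem_filter, mem_univ, true_and, mem_singleton]
      refine ⟨fun ht => ?_, by rintro rfl; exact ⟨h1, h2, h3⟩⟩
      have hzt : z ≤ t := by
        obtain ⟨e, he, hea, heu⟩ := exists_atom hua.lt
        exact cover_le h1 (fun h' => hh.2.2 (cover_le hua heu hea hh.1 h')) (hea.trans h3)
          ht.1.le (hea.trans ht.2.2)
      rcases ht.1.eq_or_eq h1.le hzt with h' | h'
      · exact absurd h3 (h' ▸ hh.2.2)
      · exact h'.symm
    rw [this, sum_singleton]
  · intro z h
    simp only [mem_filter, mem_univ, true_and]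
    constructor
    · rintro ⟨⟨h1, h2⟩, h3, h4, h5⟩
      exact ⟨⟨h4, h2, h1⟩, h3, h4.le.trans h2, h5⟩
    · rintro ⟨⟨h1, h2, h3⟩, h4, h5, h6⟩
      exact ⟨⟨h3, h2⟩, h4, h1, h6⟩

open Classical in
/-- Weisner's theorem for coatoms. -/
theorem moebius_eq_neg_sum {u a : P} (hua : u ⋖ a) {x : P} (hax : a ≤ x) :
    moebius u x = - ∑ h : P with u ≤ h ∧ h ⋖ x ∧ ¬ a ≤ h, moebius u h := by
  induction hn : rk x using Nat.strong_induction_on generalizing x with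
  | _ n ih =>
  subst hn
  have hux : u ≠ x := fun h => hua.lt.not_ge (h ▸ hax)
  have h0 := sum_moebius u x
  rw [if_neg hux, ← Finset.sum_filter_add_sum_filter_not _ (fun y => a ≤ y)] at h0
  simp only [filter_filter] at h0
  have h1 : (univ.filter fun y => (u ≤ y ∧ y ≤ x) ∧ ¬ a ≤ y)
      = univ.filter fun h => u ≤ h ∧ h ≤ x ∧ ¬ a ≤ h := by
    ext; simp [and_assoc]
  have h2 : (univ.filter fun y => (u ≤ y ∧ y ≤ x) ∧ a ≤ y)
      = univ.filter fun y => a ≤ y ∧ y ≤ x := by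
    ext y; simp only [mem_filter, mem_univ, true_and]
    exact ⟨fun h => ⟨h.2, h.1.2⟩, fun h => ⟨⟨hua.le.trans h.1, h.2⟩, h.1⟩⟩
  -- Elements not above `a` are grouped by their join `z` with `a`; by induction every group with `z
  -- ≠ x` cancels against `μ(u, z)`.
  rw [h1, h2, ← sum_cover hua hax, ← Finset.sum_add_distrib,
    Finset.sum_eq_single_of_mem x (by simp [hax])] at h0
  · linarith
  · intro z hz hzx
    simp only [mem_filter, mem_univ, true_and] at hz
    rw [ih (rk z) (rk_lt (lt_of_le_of_ne hz.2 hzx)) hz.1 rfl]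
    ring

theorem abs_moebius {u x : P} (h : u ≤ x) :
    |moebius u x| = (-1) ^ (rk u + rk x) * moebius u x := by
  classical
  suffices 0 ≤ (-1) ^ (rk u + rk x) * moebius u x by
    rw [← abs_of_nonneg this, abs_mul, abs_pow]; simp
  induction hn : rk x using Nat.strong_induction_on generalizing x with
  | _ n ih =>
  subst hn
  rcases h.eq_or_lt with rfl | hlt
  · simp [moebius_self, ← two_mul, pow_mul]
  obtain ⟨a, hua, hax⟩ := exists_covBy_le hlt
  rw [moebius_eq_neg_sum hua hax, ← Finset.sum_neg_distrib, Finset.mul_sum]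
  refine Finset.sum_nonneg fun z hz => ?_
  simp only [mem_filter, mem_univ, true_and] at hz
  have h1 := ih (rk z) (rk_lt hz.2.1.lt) hz.1 rfl
  rw [rk_covBy hz.2.1]
  rw [← add_assoc, pow_succ]
  linarith

open Classical in
/-- Crapo's formula for the beta function. -/
theorem crapoBeta_eq {e x : P} (he : IsAtom e) (hex : e ≤ x) :
    crapoBeta x = (-1) ^ rk x * - ∑ y : P with y ≤ x ∧ ¬ e ≤ y, moebius ⊥ y := by
  have hbe := bot_covBy_iff.2 he
  unfold crapoBeta
  congr 1
  rw [← Finset.sum_filter_add_sum_filter_not _ (fun y => e ≤ y)]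
  simp only [filter_filter]
  have h1 : ∑ y : P with y ≤ x ∧ e ≤ y, moebius ⊥ y * (rk y : ℤ) =
      - ∑ y : P with y ≤ x ∧ ¬ e ≤ y, moebius ⊥ y * (rk y + 1 : ℤ) := by
    have h2 := sum_cover hbe hex fun h => moebius ⊥ h * (rk h + 1 : ℤ)
    simp only [bot_le, true_and] at h2
    rw [← h2, ← Finset.sum_neg_distrib]
    refine Finset.sum_congr (by ext; simp [and_comm]) fun z hz => ?_
    simp only [mem_filter, mem_univ, true_and] at hz
    rw [moebius_eq_neg_sum hbe hz.1, neg_mul, Finset.sum_mul]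
    simp only [bot_le, true_and]
    congr 1
    refine Finset.sum_congr rfl fun h hh => ?_
    simp only [mem_filter, mem_univ, true_and] at hh
    rw [rk_covBy hh.1]; push_cast; rfl
  -- Weisner's theorem has moved the terms above `e` to elements of rank one less, so only `r(y) -
  -- (r(y) + 1) = -1` remains.
  rw [h1, ← Finset.sum_neg_distrib, ← Finset.sum_add_distrib, ← Finset.sum_neg_distrib]
  refine Finset.sum_congr rfl fun y _ => by ring

end GeometricBouquet

/-! ### Extension of a bilinear form to the exterior algebra. -/

namespace ExteriorAlgebra

variable {R M : Type*} [CommRing R] [AddCommGroup M] [Module R M]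

/-- The extension to the exterior algebra of a bilinear form on the module, `ι u * g` being paired
with `ξ` like `g` with the contraction of `ξ` by `B u`. -/
noncomputable def gramForm (B : M →ₗ[R] Module.Dual R M) :
    ExteriorAlgebra R M →ₗ[R] Module.Dual R (ExteriorAlgebra R M) :=
  (LinearMap.llcomp R _ _ _ (algebraMapInv (R := R) (M := M)).toLinearMap) ∘ₗ
    (MulOpposite.opLinearEquiv R).symm.toLinearMap ∘ₗ
    -- In `ι u * g` the contraction by `B u` acts before those coming from `g`, hence the opposite
    -- algebra.
    (ExteriorAlgebra.lift R (A := (Module.End R (ExteriorAlgebra R M))ᵐᵒᵖ)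
      ⟨(MulOpposite.opLinearEquiv R).toLinearMap ∘ₗ
        (CliffordAlgebra.contractLeft (Q := (0 : QuadraticForm R M))) ∘ₗ B, fun m => by
          refine MulOpposite.unop_injective (LinearMap.ext fun ξ => ?_)
          exact CliffordAlgebra.contractLeft_contractLeft (B m) ξ⟩).toLinearMap

variable (B : M →ₗ[R] Module.Dual R M)

theorem gramForm_one (ξ : ExteriorAlgebra R M) : gramForm B 1 ξ = algebraMapInv ξ := by
  simp [gramForm]

theorem gramForm_ι_mul (u : M) (g ξ : ExteriorAlgebra R M) :
    gramForm B (ι R u * g) ξ =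
      gramForm B g (CliffordAlgebra.contractLeft (Q := (0 : QuadraticForm R M)) (B u) ξ) := by
  simp [gramForm]

theorem contractLeft_ιMulti (φ : Module.Dual R M) {n : ℕ} (v : Fin (n + 1) → M) :
    CliffordAlgebra.contractLeft (Q := (0 : QuadraticForm R M)) φ (ιMulti R (n + 1) v) =
      ∑ j : Fin (n + 1), ((-1) ^ (j : ℕ) * φ (v j)) • ιMulti R n (v ∘ j.succAbove) := by
  induction n with
  | zero =>
    rw [ιMulti_succ_apply, CliffordAlgebra.contractLeft_ι_mul]
    simp
  | succ n ih =>
    rw [ιMulti_succ_apply, CliffordAlgebra.contractLeft_ι_mul, ih, Fin.sum_univ_succ (n := n + 1), Finset.mul_sum,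
      sub_eq_add_neg, ← Finset.sum_neg_distrib]
    congr 1
    · simp [Matrix.vecTail, Function.comp_def]
    · refine Finset.sum_congr rfl fun j _ => ?_
      rw [ιMulti_succ_apply (n := n)]
      simp only [Matrix.vecTail, Function.comp_def, Fin.val_succ, Fin.succ_succAbove_zero,
        Fin.succ_succAbove_succ, pow_succ, mul_neg, mul_one, neg_mul, neg_smul, mul_smul_comm]

/-- Contracting by the first vector is the Laplace expansion along the first row. -/
theorem gramForm_ιMulti {n : ℕ} (u v : Fin n → M) :
    gramForm B (ιMulti R n u) (ιMulti R n v) =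
      (Matrix.of fun i j => B (u i) (v j)).det := by
  induction n with
  | zero => simp [gramForm_one]
  | succ n ih =>
    rw [ιMulti_succ_apply u, gramForm_ι_mul, contractLeft_ιMulti, Matrix.det_succ_row_zero, map_sum]
    refine Finset.sum_congr rfl fun j _ => ?_
    rw [map_smul, ih, smul_eq_mul]
    rfl

theorem gramForm_ιMulti_of_ne {n m : ℕ} (h : n ≠ m) (u : Fin n → M) (v : Fin m → M) :
    gramForm B (ιMulti R n u) (ιMulti R m v) = 0 := by
  induction n generalizing m with
  | zero =>
    obtain ⟨m, rfl⟩ := Nat.exists_eq_succ_of_ne_zero h.symm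
    rw [ιMulti_zero_apply, gramForm_one, ιMulti_succ_apply, map_mul, algebraMapInv]
    simp
  | succ n ih =>
    rw [ιMulti_succ_apply u, gramForm_ι_mul]
    cases m with
    | zero =>
      rw [ιMulti_zero_apply]
      rw [CliffordAlgebra.contractLeft_one, map_zero]
    | succ m =>
      rw [contractLeft_ιMulti, map_sum]
      refine Finset.sum_eq_zero fun j _ => ?_
      rw [map_smul, ih (by omega), smul_zero]

/-- The Gram determinant of a finite family in the exterior algebra. -/
noncomputable def gramDet {κ : Type*} [Fintype κ] [DecidableEq κ]
    (f : κ → ExteriorAlgebra R M) : R :=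
  (Matrix.of fun i j => gramForm B (f i) (f j)).det

end ExteriorAlgebra

/-! ### Flags in the exterior algebra and their straightening. -/

namespace GeometricBouquet

variable {P : Type*} [PartialOrder P] [OrderBot P]
variable (R : Type*) [CommRing R]

open Classical in
/-- The indicator vector of the set of atoms below `x`. -/
noncomputable def atomVec (x : P) : {a : P // IsAtom a} → R := fun a => if a.1 ≤ x then 1 else 0

/-- The image of the indicator vector of `x` in the exterior algebra. -/
noncomputable def atomExt (x : P) : ExteriorAlgebra R ({a : P // IsAtom a} → R) :=
  ι R (atomVec R x)

/-- The products `x_k ∧ ⋯ ∧ x_1` over the maximal chains `⊥ ⋖ x₁ ⋖ ⋯ ⋖ x_k = x`. -/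
inductive IsFlagProd : P → ExteriorAlgebra R ({a : P // IsAtom a} → R) → Prop
  | one : IsFlagProd ⊥ 1
  | mul {h y : P} {k : ExteriorAlgebra R ({a : P // IsAtom a} → R)} :
      h ⋖ y → IsFlagProd h k → IsFlagProd y (atomExt R y * k)

/-- The space spanned by the flags with top `y`. -/
noncomputable def flagSpace (y : P) : Submodule R (ExteriorAlgebra R ({a : P // IsAtom a} → R)) :=
  Submodule.span R {k | IsFlagProd R y k}

variable {R}

theorem atomExt_mul_self (x : P) (k : ExteriorAlgebra R ({a : P // IsAtom a} → R)) :
    atomExt R x * (atomExt R x * k) = 0 := by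
  rw [← mul_assoc, atomExt, ι_sq_zero, zero_mul]

theorem atomVec_bot : atomVec R (⊥ : P) = 0 := by
  ext a
  simp [atomVec, le_bot_iff, a.2.1]

theorem atomExt_bot : atomExt R (⊥ : P) = 0 := by
  rw [atomExt, atomVec_bot, map_zero]

theorem atomExt_mul_flag {y : P} {k : ExteriorAlgebra R ({a : P // IsAtom a} → R)}
    (hk : k ∈ flagSpace R y) : atomExt R y * k = 0 := by
  induction hk using Submodule.span_induction with
  | mem k hk =>
    cases hk with
    | one => rw [atomExt_bot, zero_mul]
    | mul h hk => exact atomExt_mul_self _ _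
  | zero => simp
  | add a b _ _ ha hb => rw [mul_add, ha, hb, add_zero]
  | smul r a _ ha => rw [mul_smul_comm, ha, smul_zero]

theorem atomExt_mul_mem {h y : P} (hy : h ⋖ y)
    {k : ExteriorAlgebra R ({a : P // IsAtom a} → R)}
    (hk : k ∈ flagSpace R h) : atomExt R y * k ∈ flagSpace R y := by
  induction hk using Submodule.span_induction with
  | mem k hk => exact Submodule.subset_span (IsFlagProd.mul hy hk)
  | zero => simp
  | add a b _ _ ha hb => rw [mul_add]; exact add_mem ha hb
  | smul r a _ ha => rw [mul_smul_comm]; exact Submodule.smul_mem _ _ ha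

variable [Fintype P] [GeometricBouquet P]

open Classical in
-- The covers of `y` below `x` partition the atoms below `x` that are not below `y`.
theorem atomVec_sub {x y : P} (h : y ≤ x) :
    atomVec R x - atomVec R y = ∑ z : P with y ⋖ z ∧ z ≤ x, (atomVec R z - atomVec R y) := by
  ext a
  simp only [Pi.sub_apply, Finset.sum_apply]
  by_cases hay : a.1 ≤ y
  · rw [Finset.sum_eq_zero]
    · simp [atomVec, hay, hay.trans h]
    · intro z hz
      simp only [mem_filter, mem_univ, true_and] at hz
      simp [atomVec, hay, hay.trans hz.1.le]
  by_cases hax : a.1 ≤ x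
  · obtain ⟨z, h1, h2, h3⟩ := exists_cover a.2 hax h hay
    rw [Finset.sum_eq_single_of_mem z (by simp [h1, h2])]
    · simp [atomVec, hax, h3]
    · intro t ht htz
      simp only [mem_filter, mem_univ, true_and] at ht
      have : ¬ a.1 ≤ t := fun hat => htz (cover_unique hay ht.1 hat h1 h3)
      simp [atomVec, this, hay]
  · rw [Finset.sum_eq_zero]
    · simp [atomVec, hay, hax]
    · intro z hz
      simp only [mem_filter, mem_univ, true_and] at hz
      have : ¬ a.1 ≤ z := fun h => hax (h.trans hz.2)
      simp [atomVec, hay, this]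

open Classical in
-- A flag with top `y` is killed by `y`, so `x` may be replaced by `x - y`. This is the only linear
-- relation the straightening uses.
theorem atomExt_mul_eq_sum {x y : P} (h : y ≤ x)
    {k : ExteriorAlgebra R ({a : P // IsAtom a} → R)} (hk : k ∈ flagSpace R y) :
    atomExt R x * k = ∑ z : P with y ⋖ z ∧ z ≤ x, atomExt R z * k := by
  have h1 := congrArg (fun u => ι R u * k) (atomVec_sub (R := R) h)
  simp only [map_sub, map_sum, sub_mul, Finset.sum_mul] at h1
  have h2 : ι R (atomVec R y) * k = 0 := atomExt_mul_flag hk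
  simp only [h2, sub_zero] at h1
  exact h1

open Classical in
/-- The relation between the flags through `h`, with one term split off. -/
theorem atomExt_mul_eq_sub {h y x : P} (hy : h ⋖ y) (hyx : y ≤ x)
    {k : ExteriorAlgebra R ({a : P // IsAtom a} → R)} (hk : k ∈ flagSpace R h) :
    atomExt R y * k =
      atomExt R x * k - ∑ z ∈ univ.filter (fun z => h ⋖ z ∧ z ≤ x) \ {y}, atomExt R z * k := by
  rw [atomExt_mul_eq_sum (hy.le.trans hyx) hk,
    ← Finset.sum_sdiff (s₁ := {y}) (s₂ := univ.filter fun z => h ⋖ z ∧ z ≤ x)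
      (by simp [hy, hyx]), sum_singleton]
  abel

/-- If `y` lies above `e`, induction first makes the step below `y` avoid `e`, say at `h`. The
relation at `h` then trades `y` for the other covers of `h` below `x`. These avoid `e`, since only
one cover of `h` lies above `e`, and the term with `x` dies because `x ∧ x = 0`. -/
theorem atomExt_mul_mem_span {e x y : P} (he : IsAtom e) (hex : e ≤ x) (hyx : y ≤ x)
    {k : ExteriorAlgebra R ({a : P // IsAtom a} → R)} (hk : k ∈ flagSpace R y) :
    atomExt R x * k ∈ Submodule.span R {m | ∃ h k', h ≤ x ∧ rk h = rk y ∧ ¬ e ≤ h ∧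
      k' ∈ flagSpace R h ∧ m = atomExt R x * k'} := by
  classical
  induction hn : rk x using Nat.strong_induction_on generalizing x y k with
  | _ n ih =>
  subst hn
  by_cases hey : e ≤ y
  swap
  · exact Submodule.subset_span ⟨y, k, hyx, rfl, hey, hk, rfl⟩
  rcases hyx.eq_or_lt with rfl | hlt
  · rw [atomExt_mul_flag hk]; exact zero_mem _
  have hk2 : k ∈ Submodule.span R {m | ∃ h k', h ≤ y ∧ rk y = rk h + 1 ∧ ¬ e ≤ h ∧
      k' ∈ flagSpace R h ∧ m = atomExt R y * k'} := by
    refine Submodule.span_le.2 (fun m hm => ?_) hk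
    rcases hm with _ | ⟨hc, hk'⟩
    · exact absurd (le_bot_iff.1 hey) he.1
    · refine Submodule.span_mono ?_
        (ih (rk y) (rk_lt hlt) hey hc.le (Submodule.subset_span hk') rfl)
      rintro _ ⟨h', k', h1, h2, h3, h4, h5⟩
      exact ⟨h', k', h1, by rw [h2, rk_covBy hc], h3, h4, h5⟩
  clear hk
  induction hk2 using Submodule.span_induction with
  | zero => simp
  | add a b _ _ ha hb =>
    rw [mul_add]
    exact add_mem ha hb
  | smul r a _ ha => rw [mul_smul_comm]; exact Submodule.smul_mem _ _ ha
  | mem m hm =>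
    obtain ⟨h, k', h1, h2, h3, h4, rfl⟩ := hm
    have hc : h ⋖ y := covBy_of_rk h1 h2
    rw [atomExt_mul_eq_sub hc hyx h4, mul_sub, atomExt_mul_self, zero_sub, Finset.mul_sum]
    refine neg_mem (sum_mem fun z hz => Submodule.subset_span
      ⟨z, atomExt R z * k', ?_, ?_, ?_, ?_, rfl⟩)
    all_goals simp only [mem_sdiff, mem_filter, mem_univ, true_and, mem_singleton] at hz
    · exact hz.1.2
    · rw [h2, rk_covBy hz.1.1]
    · exact fun hez => hz.2 (cover_unique h3 hz.1.1 hez hc hey)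
    · exact atomExt_mul_mem hz.1.1 h4

theorem flagSpace_le_span {e y : P} (he : IsAtom e) (hey : e ≤ y) :
    flagSpace R y ≤ Submodule.span R {m | ∃ h k', h ⋖ y ∧ ¬ e ≤ h ∧
      k' ∈ flagSpace R h ∧ m = atomExt R y * k'} := by
  refine Submodule.span_le.2 (fun m hm => ?_)
  rcases hm with _ | ⟨hc, hk'⟩
  · exact absurd (le_bot_iff.1 hey) he.1
  · refine Submodule.span_mono ?_
      (atomExt_mul_mem_span he hey hc.le (Submodule.subset_span hk'))
    rintro _ ⟨h', k', h1, h2, h3, h4, h5⟩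
    exact ⟨h', k', covBy_of_rk h1 (by rw [h2, rk_covBy hc]), h3, h4, h5⟩

theorem contractLeft_mem (φ : Module.Dual R ({a : P // IsAtom a} → R)) {y : P}
    {k : ExteriorAlgebra R ({a : P // IsAtom a} → R)} (hk : k ∈ flagSpace R y) :
    CliffordAlgebra.contractLeft (Q := (0 : QuadraticForm R _)) φ k ∈
      ⨆ h : {h : P // h ⋖ y}, flagSpace R h.1 := by
  classical
  induction hk using Submodule.span_induction with
  | zero => simp
  | add a b _ _ ha hb => rw [map_add]; exact add_mem ha hb
  | smul r a _ ha => rw [map_smul]; exact Submodule.smul_mem _ _ ha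
  | mem k hk =>
  induction hk with
  | one => rw [CliffordAlgebra.contractLeft_one]; exact zero_mem _
  | @mul h y k hc hk ih =>
    rw [atomExt, CliffordAlgebra.contractLeft_ι_mul]
    refine sub_mem (Submodule.smul_mem _ _ ?_) ?_
    · exact Submodule.mem_iSup_of_mem ⟨h, hc⟩ (Submodule.subset_span hk)
    · change atomExt R y * _ ∈ _
      refine Submodule.iSup_induction _ (motive := fun m => atomExt R y * m ∈ _) ih ?_ ?_ ?_
      · intro h' m hm
        -- Contraction below `h` leaves a gap of two ranks under `y`, filled by the elements `z` in
        -- between.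
        rw [atomExt_mul_eq_sum (h'.2.le.trans hc.le) hm]
        refine sum_mem fun z hz => ?_
        simp only [mem_filter, mem_univ, true_and] at hz
        refine Submodule.mem_iSup_of_mem ⟨z, covBy_of_rk hz.2 ?_⟩ (atomExt_mul_mem hz.1 hm)
        rw [rk_covBy hz.1, rk_covBy hc, rk_covBy h'.2]
      · rw [mul_zero]; exact zero_mem _
      · intro a b ha hb
        rw [mul_add]; exact add_mem ha hb

end GeometricBouquet

/-! ### Gram determinants. -/

namespace ExteriorAlgebra

variable {R M : Type*} [CommRing R] [AddCommGroup M] [Module R M]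
variable (B : M →ₗ[R] Module.Dual R M)
variable {κ κ' : Type*} [Fintype κ] [DecidableEq κ] [Fintype κ'] [DecidableEq κ']

theorem gramDet_comp_equiv (e : κ' ≃ κ) (f : κ → ExteriorAlgebra R M) :
    gramDet B (f ∘ e) = gramDet B f :=
  Matrix.det_submatrix_equiv_self e (Matrix.of fun i j => gramForm B (f i) (f j))

theorem exists_gramDet_eq_mul {f g : κ → ExteriorAlgebra R M}
    (h : ∀ i, g i ∈ Submodule.span R (Set.range f)) :
    ∃ c : R, gramDet B g = c * c * gramDet B f := by
  choose T hT using fun i => (Submodule.mem_span_range_iff_exists_fun R).1 (h i)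
  refine ⟨(Matrix.of T).det, ?_⟩
  have : (Matrix.of fun i j => gramForm B (g i) (g j)) =
      Matrix.of T * (Matrix.of fun i j => gramForm B (f i) (f j)) * (Matrix.of T).transpose := by
    ext i j
    simp only [← hT, map_sum, map_smul, LinearMap.sum_apply, LinearMap.smul_apply, smul_eq_mul,
      Matrix.of_apply, Matrix.mul_apply, Matrix.transpose_apply, Finset.sum_mul, Finset.mul_sum]
    refine Finset.sum_congr rfl fun a _ => Finset.sum_congr rfl fun b _ => ?_
    ring
  unfold gramDet
  rw [this, Matrix.det_mul, Matrix.det_mul, Matrix.det_transpose]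
  ring

/-- Over a domain in which every unit is its own inverse, two families of the same size
that generate the same module have the same Gram determinant. -/
theorem gramDet_eq_of_span [IsDomain R] (hR : ∀ u : R, IsUnit u → u * u = 1) (e : κ' ≃ κ)
    {f : κ → ExteriorAlgebra R M} {g : κ' → ExteriorAlgebra R M}
    (hgf : ∀ i, g i ∈ Submodule.span R (Set.range f))
    (hfg : ∀ i, f i ∈ Submodule.span R (Set.range g)) :
    gramDet B f = gramDet B g := by
  rw [← gramDet_comp_equiv B e.symm g]
  have hr : Set.range (g ∘ e.symm) = Set.range g := e.symm.surjective.range_comp g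
  obtain ⟨c, hc⟩ := exists_gramDet_eq_mul B (f := f) (g := g ∘ e.symm) fun i => hgf _
  obtain ⟨d, hd⟩ := exists_gramDet_eq_mul B (f := g ∘ e.symm) (g := f) fun i => by
    rw [hr]; exact hfg i
  by_cases h0 : gramDet B f = 0
  · rw [hc, h0, mul_zero]
  -- No independence is needed: if the determinant is nonzero, comparing it with itself through both
  -- transition matrices makes `c` a unit.
  · have h1 : (d * c) * (d * c) = 1 := by
      refine mul_right_cancel₀ h0 ?_
      rw [one_mul]
      conv_rhs => rw [hd, hc]
      ring
    have hu : IsUnit c := IsUnit.of_mul_eq_one (d * c * d) (by rw [← h1]; ring)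
    rw [hc, hR c hu, one_mul]

/-- The Gram determinant of a family with pairwise orthogonal parts. -/
theorem gramDet_sigma {I : Type*} [Fintype I] [DecidableEq I] {τ : I → Type*}
    [∀ i, Fintype (τ i)] [∀ i, DecidableEq (τ i)] (f : (Σ i, τ i) → ExteriorAlgebra R M)
    (h : ∀ a b, a.1 ≠ b.1 → gramForm B (f a) (f b) = 0) :
    gramDet B f = ∏ i, gramDet B (fun t => f ⟨i, t⟩) := by
  let _ : LinearOrder I := LinearOrder.lift' (Fintype.equivFin I) (Fintype.equivFin I).injective
  have hb : (Matrix.of fun a b => gramForm B (f a) (f b)).BlockTriangular Sigma.fst :=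
    fun a b hab => h a b hab.ne'
  unfold gramDet
  rw [hb.det_fintype]
  refine Finset.prod_congr rfl fun i _ => ?_
  rw [← Matrix.det_submatrix_equiv_self (Equiv.sigmaSubtype i).symm]
  congr 1

/-- The Gram determinants of a family `z` annihilated by `ι v` and of the images under `ι v` of a
family `u`. -/
theorem gramDet_mul_gramDet (v : M) (z : κ' → ExteriorAlgebra R M) (u : κ → ExteriorAlgebra R M)
    (hz : ∀ j, ι R v * z j = 0)
    (hu : ∀ i, ι R v * CliffordAlgebra.contractLeft (Q := (0 : QuadraticForm R M)) (B v) (u i) ∈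
      Submodule.span R (Set.range z)) :
    gramDet B z * gramDet B (fun i => ι R v * u i) =
      B v v ^ Fintype.card κ * gramDet B (Sum.elim z u) := by
  choose T hT using fun i => (Submodule.mem_span_range_iff_exists_fun R).1 (hu i)
  have hc : ∀ i, CliffordAlgebra.contractLeft (Q := (0 : QuadraticForm R M)) (B v) (ι R v * u i) =
      B v v • u i - ∑ j, T i j • z j := fun i => by
    rw [hT, CliffordAlgebra.contractLeft_ι_mul]
  -- The column operation replaces `u j` by the contraction of `v ∧ u j`. Pairing this with `g`
  -- gives the pairing of `v ∧ g` with `v ∧ u j`, which vanishes for `g = z i`; the result is block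
  -- triangular.
  have h1 : (Matrix.of fun a b => gramForm B (Sum.elim z u a) (Sum.elim z u b)) *
      Matrix.fromBlocks 1 (Matrix.of fun j i => - T i j) 0 (B v v • 1) =
      Matrix.fromBlocks (Matrix.of fun i j => gramForm B (z i) (z j)) 0
        (Matrix.of fun i j => gramForm B (u i) (z j))
        (Matrix.of fun i j => gramForm B (ι R v * u i) (ι R v * u j)) := by
    have key : ∀ (g : ExteriorAlgebra R M) (j : κ), gramForm B (ι R v * g) (ι R v * u j) =
        (∑ i, gramForm B g (z i) * - T j i) + gramForm B g (u j) * B v v := by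
      intro g j
      rw [gramForm_ι_mul, hc, map_sub, map_smul, map_sum, smul_eq_mul, sub_eq_neg_add,
        ← Finset.sum_neg_distrib, mul_comm (B v v)]
      congr 1
      refine Finset.sum_congr rfl fun i _ => ?_
      rw [map_smul, smul_eq_mul, mul_neg, mul_comm]
    have hb : (Matrix.of fun a b => gramForm B (Sum.elim z u a) (Sum.elim z u b)) =
        Matrix.fromBlocks (Matrix.of fun i j => gramForm B (z i) (z j))
          (Matrix.of fun i j => gramForm B (z i) (u j))
          (Matrix.of fun i j => gramForm B (u i) (z j))
          (Matrix.of fun i j => gramForm B (u i) (u j)) := by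
      ext (a | a) (b | b) <;> rfl
    rw [hb, Matrix.fromBlocks_multiply]
    congr 1
    · simp
    · ext i j
      have := key (z i) j
      rw [hz, map_zero, LinearMap.zero_apply] at this
      rw [Matrix.mul_smul, Matrix.mul_one, Matrix.add_apply, Matrix.mul_apply, Matrix.smul_apply]
      simp only [Matrix.of_apply, Matrix.zero_apply, smul_eq_mul]
      rw [this, mul_comm (B v v)]
    · simp
    · ext i j
      rw [Matrix.mul_smul, Matrix.mul_one, Matrix.add_apply, Matrix.mul_apply, Matrix.smul_apply]
      simp only [Matrix.of_apply, smul_eq_mul]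
      rw [key, mul_comm (B v v)]
  have h2 := congrArg Matrix.det h1
  rw [Matrix.det_mul, Matrix.det_fromBlocks_zero₂₁, Matrix.det_fromBlocks_zero₁₂, Matrix.det_one,
    one_mul, Matrix.det_smul, Matrix.det_one, mul_one] at h2
  unfold gramDet
  rw [← h2, mul_comm]

end ExteriorAlgebra

/-! ### Neat chains, generating tuples and their pairing. -/

namespace GeometricBouquet

variable {P : Type*} [PartialOrder P] [OrderBot P]

/-- The neat chains `⊥ ⋖ x₁ ⋖ ⋯ ⋖ x_k = y`, written as lists `[x_k, …, x₁]`. -/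
inductive IsNeatList (l : P → P) : P → List P → Prop
  | nil : IsNeatList l ⊥ []
  | cons {h y : P} {L : List P} : h ⋖ y → ¬ l y ≤ h → IsNeatList l h L → IsNeatList l y (y :: L)

/-- The neat chains as sequences `⊥ = c₀ ⋖ c₁ ⋖ ⋯ ⋖ c_n`. -/
structure IsNeatSeq (l : P → P) {n : ℕ} (c : Fin (n + 1) → P) : Prop where
  zero : c 0 = ⊥
  covBy : ∀ i : Fin n, c i.castSucc ⋖ c i.succ
  neat : ∀ i : Fin n, ¬ l (c i.succ) ≤ c i.castSucc

/-- The list `[c_n, …, c₁]`. -/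
def descList {n : ℕ} (c : Fin (n + 1) → P) : List P := List.ofFn fun i : Fin n => c (Fin.rev i).succ

theorem IsNeatSeq.isNeatList {l : P → P} {n : ℕ} {c : Fin (n + 1) → P} (hc : IsNeatSeq l c) :
    IsNeatList l (c (Fin.last n)) (descList c) := by
  induction n with
  | zero => rw [show Fin.last 0 = 0 from rfl, hc.zero]; exact .nil
  | succ n ih =>
    have h1 : IsNeatSeq l (fun i : Fin (n + 1) => c i.castSucc) :=
      ⟨hc.zero, fun i => hc.covBy i.castSucc, fun i => hc.neat i.castSucc⟩
    have h2 := IsNeatList.cons (hc.covBy (Fin.last n)) (hc.neat (Fin.last n)) (ih h1)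
    have h3 : descList c = c (Fin.last n).succ :: descList (fun i : Fin (n + 1) => c i.castSucc) := by
      rw [descList, List.ofFn_succ, descList]
      congr 1
      congr 1
      funext i
      rw [Fin.rev_succ]
      rfl
    rw [h3, ← Fin.succ_last]
    exact h2

theorem IsNeatList.exists_seq {l : P → P} {y : P} {L : List P} (h : IsNeatList l y L) :
    ∃ (n : ℕ) (c : Fin (n + 1) → P), IsNeatSeq l c ∧ c (Fin.last n) = y ∧ descList c = L := by
  induction h with
  | nil => exact ⟨0, fun _ => ⊥, ⟨rfl, fun i => i.elim0, fun i => i.elim0⟩, rfl, rfl⟩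
  | @cons h y L hc hl _ ih =>
    obtain ⟨n, c, h1, h2, rfl⟩ := ih
    refine ⟨n + 1, Fin.snoc c y, ⟨?_, fun i => ?_, fun i => ?_⟩, Fin.snoc_last _ _, ?_⟩
    · rw [← Fin.castSucc_zero, Fin.snoc_castSucc, h1.zero]
    · induction i using Fin.lastCases with
      | last => rw [Fin.succ_last, Fin.snoc_last, Fin.snoc_castSucc, h2]; exact hc
      | cast i => rw [Fin.succ_castSucc, Fin.snoc_castSucc, Fin.snoc_castSucc]; exact h1.covBy i
    · induction i using Fin.lastCases with
      | last => rw [Fin.succ_last, Fin.snoc_last, Fin.snoc_castSucc, h2]; exact hl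
      | cast i => rw [Fin.succ_castSucc, Fin.snoc_castSucc, Fin.snoc_castSucc]; exact h1.neat i
    · rw [descList, List.ofFn_succ]
      congr 1
      · rw [Fin.rev_zero, Fin.succ_last, Fin.snoc_last]
      · rw [descList]
        congr 1
        funext i
        rw [Fin.rev_succ, Fin.succ_castSucc, Fin.snoc_castSucc]

theorem IsNeatSeq.monotone {l : P → P} {n : ℕ} {c : Fin (n + 1) → P} (hc : IsNeatSeq l c) :
    Monotone c := Fin.monotone_iff_le_succ.2 fun i => (hc.covBy i).le

section generation

variable [Fintype P] [GeometricBouquet P] {l : P → P} {n : ℕ} {c : Fin (n + 1) → P}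
  {a : Fin n → {a : P // IsAtom a}}

theorem IsNeatSeq.le_of_mem_upperBounds (hc : IsNeatSeq l c)
    (ha : ∀ i, (a i : P) ≤ c i.succ ∧ ¬ (a i : P) ≤ c i.castSucc) {t : P} (k : Fin (n + 1))
    (ht : ∀ j : Fin n, j.castSucc < k → (a j : P) ≤ t) : c k ≤ t := by
  induction k using Fin.induction with
  | zero => rw [hc.zero]; exact bot_le
  | succ i ih =>
    exact cover_le (hc.covBy i) (ha i).2 (ha i).1
      (ih fun j hj => ht j (hj.trans (Fin.castSucc_lt_succ))) (ht i (Fin.castSucc_lt_succ))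

/-- Generation becomes a separate condition on each atom, so sums over generating tuples factor into
matrix entries. -/
theorem IsNeatSeq.isLUB_iff (hc : IsNeatSeq l c) :
    (∀ i : Fin n, IsLUB ((fun j => (a j : P)) '' Set.Iic i) (c i.succ)) ↔
      ∀ i, (a i : P) ≤ c i.succ ∧ ¬ (a i : P) ≤ c i.castSucc := by
  constructor
  · intro h i
    refine ⟨(h i).1 ⟨i, Set.mem_Iic.2 le_rfl, rfl⟩, fun hi => ?_⟩
    refine (hc.covBy i).lt.not_ge ((h i).2 ?_)
    rintro _ ⟨j, hj, rfl⟩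
    rcases (show j ≤ i from hj).eq_or_lt with rfl | hj
    · exact hi
    · exact ((h j).1 ⟨j, Set.mem_Iic.2 le_rfl, rfl⟩).trans (hc.monotone (by
        rw [Fin.le_def]; exact hj))
  · intro h i
    constructor
    · rintro _ ⟨j, hj, rfl⟩
      exact (h j).1.trans (hc.monotone (Fin.succ_le_succ_iff.2 hj))
    · intro t ht
      refine hc.le_of_mem_upperBounds h i.succ fun j hj => ht ⟨j, ?_, rfl⟩
      exact Fin.le_castSucc_iff.2 hj

/-- The top depends only on the set of atoms used, so a tuple and a permutation of it cannot
generate chains with different tops. -/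
theorem IsNeatSeq.isLUB_range (hc : IsNeatSeq l c)
    (h : ∀ i, (a i : P) ≤ c i.succ ∧ ¬ (a i : P) ≤ c i.castSucc) :
    IsLUB (Set.range fun j => (a j : P)) (c (Fin.last n)) := by
  constructor
  · rintro _ ⟨j, rfl⟩
    exact (h j).1.trans (hc.monotone (Fin.le_last _))
  · intro t ht
    exact hc.le_of_mem_upperBounds h _ fun j _ => ht ⟨j, rfl⟩

end generation

section pairing

variable {R : Type*} [CommRing R] [Fintype P]

open Classical in
/-- The bilinear form on the vectors indexed by the atoms, with matrix `diag (w)`. -/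
noncomputable def atomForm (w : P → R) :
    ({a : P // IsAtom a} → R) →ₗ[R] Module.Dual R ({a : P // IsAtom a} → R) :=
  LinearMap.mk₂ R (fun u v => ∑ a, w a.1 * u a * v a)
    (fun u u' v => by simp only [Pi.add_apply, mul_add, add_mul, sum_add_distrib])
    (fun r u v => by
      simp only [Pi.smul_apply, smul_eq_mul, Finset.mul_sum]
      exact Finset.sum_congr rfl fun a _ => by ring)
    (fun u u' v => by simp only [Pi.add_apply, mul_add, sum_add_distrib])
    (fun r u v => by
      simp only [Pi.smul_apply, smul_eq_mul, Finset.mul_sum]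
      exact Finset.sum_congr rfl fun a _ => by ring)

open Classical in
/-- The sum of the weights of the atoms below `x`. -/
noncomputable def atomWeight (w : P → R) (x : P) : R :=
  ∑ a : {a : P // IsAtom a}, if a.1 ≤ x then w a.1 else 0

theorem atomForm_atomVec (w : P → R) (x : P) :
    atomForm w (atomVec R x) (atomVec R x) = atomWeight w x := by
  simp only [atomForm, LinearMap.mk₂_apply, atomVec, atomWeight]
  exact Finset.sum_congr rfl fun a _ => by split_ifs <;> simp

open Classical in
theorem atomForm_sub {y x y' x' : P} (h : y ≤ x) (h' : y' ≤ x') (w : P → R) :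
    atomForm w (atomVec R x - atomVec R y) (atomVec R x' - atomVec R y') =
      ∑ a : {a : P // IsAtom a},
        if (a.1 ≤ x ∧ ¬ a.1 ≤ y) ∧ (a.1 ≤ x' ∧ ¬ a.1 ≤ y') then w a.1 else 0 := by
  simp only [atomForm, LinearMap.mk₂_apply, atomVec, Pi.sub_apply]
  refine Finset.sum_congr rfl fun a _ => ?_
  by_cases h1 : a.1 ≤ y <;> by_cases h2 : a.1 ≤ y'
  · simp [h1, h1.trans h]
  · simp [h1, h1.trans h]
  · simp [h2, h2.trans h']
  · by_cases h3 : a.1 ≤ x <;> by_cases h4 : a.1 ≤ x' <;> simp [h1, h2, h3, h4]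

variable (R) in
/-- The product of the vectors of the elements of a list. -/
noncomputable def listExt (L : List P) : ExteriorAlgebra R ({a : P // IsAtom a} → R) :=
  (L.map (atomExt R)).prod

theorem listExt_descList {n : ℕ} (c : Fin (n + 1) → P) :
    listExt R (descList c) = ιMulti R n (fun i => atomVec R (c (Fin.rev i).succ)) := by
  rw [ιMulti_apply, listExt, descList, List.map_ofFn]
  rfl

/-- Subtracting from each row, and then each column, its predecessor does not change the
determinant; the predecessor of the first one is the zero vector of `⊥`. The descending order of the
lists reverses rows and columns alike and costs no sign. -/
theorem det_atomForm_sub {l l' : P → P} (w : P → R) {n : ℕ} {c c' : Fin (n + 1) → P}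
    (hc : IsNeatSeq l c) (hc' : IsNeatSeq l' c') :
    gramForm (atomForm w) (listExt R (descList c)) (listExt R (descList c')) =
      (Matrix.of fun i j : Fin n => atomForm w (atomVec R (c i.succ) - atomVec R (c i.castSucc))
        (atomVec R (c' j.succ) - atomVec R (c' j.castSucc))).det := by
  rw [listExt_descList, listExt_descList, gramForm_ιMulti]
  trans (Matrix.of fun i j : Fin n => atomForm w (atomVec R (c i.succ)) (atomVec R (c' j.succ))).det
  · rw [← Matrix.det_submatrix_equiv_self Fin.revPerm
      (Matrix.of fun i j : Fin n => atomForm w (atomVec R (c i.succ)) (atomVec R (c' j.succ)))]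
    rfl
  cases n with
  | zero => simp
  | succ n =>
    trans (Matrix.of fun i j : Fin (n + 1) => atomForm w
      (atomVec R (c i.succ) - atomVec R (c i.castSucc)) (atomVec R (c' j.succ))).det
    · refine Matrix.det_eq_of_forall_row_eq_smul_add_pred (fun _ => 1) (fun j => ?_) fun i j => ?_
      · simp [hc.zero, atomVec_bot]
      · simp
    · refine Matrix.det_eq_of_forall_col_eq_smul_add_pred (fun _ => 1) (fun j => ?_) fun i j => ?_
      · simp [hc'.zero, atomVec_bot]
      · simp
        abel

open Classical in
/-- The pairing of two chains as a sum over the tuples of atoms generating them. -/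
theorem gramForm_listExt_eq_sum {l l' : P → P} (w : P → R) {n : ℕ} {c c' : Fin (n + 1) → P}
    (hc : IsNeatSeq l c) (hc' : IsNeatSeq l' c') :
    gramForm (atomForm w) (listExt R (descList c)) (listExt R (descList c')) =
      ∑ a : Fin n → {a : P // IsAtom a}, ∑ σ : Equiv.Perm (Fin n),
        if (∀ i, (a i : P) ≤ c i.succ ∧ ¬ (a i : P) ≤ c i.castSucc) ∧
          (∀ i, (a (σ i) : P) ≤ c' i.succ ∧ ¬ (a (σ i) : P) ≤ c' i.castSucc) then
          ((Equiv.Perm.sign σ : ℤ) : R) * ∏ i, w (a i) else 0 := by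
  rw [det_atomForm_sub w hc hc', Matrix.det_apply', Finset.sum_comm]
  refine Finset.sum_congr rfl fun σ _ => ?_
  simp only [Matrix.of_apply, atomForm_sub (hc.covBy _).le (hc'.covBy _).le]
  rw [Finset.prod_univ_sum, Fintype.piFinset_univ, Finset.mul_sum]
  -- Expanding the Leibniz formula indexes the atoms by columns, while `a` is indexed by rows; the
  -- two tuples differ by `σ`.
  rw [← Equiv.sum_comp (Equiv.arrowCongr σ.symm (Equiv.refl {a : P // IsAtom a}))]
  refine Finset.sum_congr rfl fun a _ => ?_
  simp only [Equiv.arrowCongr_apply, Equiv.coe_refl, Function.comp_def, id, Equiv.symm_symm]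
  split_ifs with h
  · congr 1
    rw [← Equiv.prod_comp σ fun i => w (a i)]
    refine Finset.prod_congr rfl fun i _ => ?_
    rw [if_pos ⟨h.1 _, h.2 _⟩]
  · have : ∃ i, ¬ (((a (σ i) : P) ≤ c (σ i).succ ∧ ¬ (a (σ i) : P) ≤ c (σ i).castSucc) ∧
        ((a (σ i) : P) ≤ c' i.succ ∧ ¬ (a (σ i) : P) ≤ c' i.castSucc)) := by
      by_contra! h'
      refine h ⟨fun i => ?_, fun i => (h' i).2⟩
      simpa using (h' (σ.symm i)).1
    obtain ⟨i, hi⟩ := this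
    rw [Finset.prod_eq_zero (mem_univ i) (if_neg hi), mul_zero]

variable [GeometricBouquet P]

/-- Chains with different tops are orthogonal. -/
theorem gramForm_listExt_of_ne {l l' : P → P} (w : P → R) {y y' : P} {L L' : List P}
    (hL : IsNeatList l y L) (hL' : IsNeatList l' y' L') (hne : y ≠ y') :
    gramForm (atomForm w) (listExt R L) (listExt R L') = 0 := by
  classical
  obtain ⟨n, c, hc, rfl, rfl⟩ := hL.exists_seq
  obtain ⟨m, c', hc', rfl, rfl⟩ := hL'.exists_seq
  by_cases hnm : n = m
  · subst hnm
    rw [gramForm_listExt_eq_sum w hc hc']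
    refine Finset.sum_eq_zero fun a _ => Finset.sum_eq_zero fun σ _ => if_neg fun h => hne ?_
    have h1 := hc.isLUB_range h.1
    have h2 := hc'.isLUB_range (a := a ∘ σ) h.2
    refine h1.unique ?_
    convert h2 using 1
    exact (σ.surjective.range_comp fun j => (a j : P)).symm
  · rw [listExt_descList, listExt_descList, gramForm_ιMulti_of_ne _ hnm]

end pairing

end GeometricBouquet

/-! ### Counting neat chains and the recursion over rank levels. -/

namespace GeometricBouquet

variable {P : Type*} [PartialOrder P] [OrderBot P] [Fintype P]

section count

/-- Removing the top of a neat chain. -/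
noncomputable def neatListEquiv (l : P → P) {y : P} (hy : y ≠ ⊥) :
    {L : List P // IsNeatList l y L} ≃
      Σ h : {h : P // h ⋖ y ∧ ¬ l y ≤ h}, {L : List P // IsNeatList l h.1 L} := by
  refine (Equiv.ofBijective (fun a => ⟨y :: a.2.1, .cons a.1.2.1 a.1.2.2 a.2.2⟩) ⟨?_, ?_⟩).symm
  · rintro ⟨⟨h, h1⟩, L, hL⟩ ⟨⟨h', h1'⟩, L', hL'⟩ heq
    obtain rfl : L = L' := by simpa using heq
    obtain rfl : h = h' := by
      cases hL with
      | nil => cases hL'; rfl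
      | cons _ _ _ => cases hL'; rfl
    rfl
  · rintro ⟨L, hL⟩
    cases hL with
    | nil => exact absurd rfl hy
    | @cons h _ L hc hl hL => exact ⟨⟨⟨h, hc, hl⟩, L, hL⟩, rfl⟩

instance finite_neatList (l : P → P) (y : P) : Finite {L : List P // IsNeatList l y L} := by
  induction hn : rk y using Nat.strong_induction_on generalizing y with
  | _ n ih =>
  subst hn
  by_cases hy : y = ⊥
  · subst hy
    refine @Finite.of_subsingleton _ ⟨?_⟩
    rintro ⟨L, hL⟩ ⟨L', hL'⟩
    cases hL with
    | nil =>
      cases hL' with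
      | nil => rfl
      | cons h _ _ => exact absurd h not_covBy_bot
    | cons h _ _ => exact absurd h not_covBy_bot
  · have (h : {h : P // h ⋖ y ∧ ¬ l y ≤ h}) : Finite {L : List P // IsNeatList l h.1 L} :=
      ih _ (rk_lt h.2.1.lt) _ rfl
    exact Finite.of_equiv _ (neatListEquiv l hy).symm

noncomputable instance (l : P → P) (y : P) : Fintype {L : List P // IsNeatList l y L} :=
  Fintype.ofFinite _

/-- The number of neat chains with top `y`. -/
noncomputable def neatCount (l : P → P) (y : P) : ℕ := Fintype.card {L : List P // IsNeatList l y L}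

theorem neatCount_bot (l : P → P) : neatCount l (⊥ : P) = 1 := by
  refine Fintype.card_eq_one_iff.2 ⟨⟨[], .nil⟩, ?_⟩
  rintro ⟨L, hL⟩
  cases hL with
  | nil => rfl
  | cons h _ _ => exact absurd h not_covBy_bot

open Classical in
theorem neatCount_eq_sum (l : P → P) {y : P} (hy : y ≠ ⊥) :
    neatCount l y = ∑ h : P with h ⋖ y ∧ ¬ l y ≤ h, neatCount l h := by
  rw [neatCount, Fintype.card_congr (neatListEquiv l hy), Fintype.card_sigma]
  exact (Finset.sum_subtype _ (by simp) (neatCount l)).symm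

variable [GeometricBouquet P] {l : P → P}

/-- Removing the top gives the recursion of Weisner's theorem for the atom `l y`. -/
theorem neatCount_eq (hl : IsAtomLabeling l) (y : P) :
    (neatCount l y : ℤ) = (-1) ^ rk y * moebius ⊥ y := by
  classical
  induction hn : rk y using Nat.strong_induction_on generalizing y with
  | _ n ih =>
  subst hn
  by_cases hy : y = ⊥
  · subst hy
    simp [neatCount_bot, moebius_self, rk_bot]
  · rw [neatCount_eq_sum l hy, moebius_eq_neg_sum (bot_covBy_iff.2 (hl y hy).1) (hl y hy).2]
    simp only [bot_le, true_and]
    rw [← Finset.sum_neg_distrib, Finset.mul_sum]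
    push_cast
    refine Finset.sum_congr rfl fun h hh => ?_
    simp only [mem_filter, mem_univ, true_and] at hh
    rw [ih _ (rk_lt hh.1.lt) _ rfl, rk_covBy hh.1]
    ring

open Classical in
-- The count is a Möbius value, so the recursion holds for every atom below `y`, not only for the
-- label.
theorem neatCount_eq_sum_of_isAtom (hl : IsAtomLabeling l) {e y : P} (he : IsAtom e) (hey : e ≤ y) :
    neatCount l y = ∑ h : P with h ⋖ y ∧ ¬ e ≤ h, neatCount l h := by
  zify
  rw [neatCount_eq hl, moebius_eq_neg_sum (bot_covBy_iff.2 he) hey]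
  simp only [bot_le, true_and]
  rw [← Finset.sum_neg_distrib, Finset.mul_sum]
  refine Finset.sum_congr rfl fun h hh => ?_
  simp only [mem_filter, mem_univ, true_and] at hh
  rw [neatCount_eq hl, rk_covBy hh.1]
  ring

end count

section families

/-- The neat chains with top satisfying `T`. -/
abbrev NeatTop (l : P → P) (T : P → Prop) : Type _ :=
  Σ y : {y : P // T y}, {L : List P // IsNeatList l y.1 L}

noncomputable instance (l : P → P) (T : P → Prop) : Fintype (NeatTop l T) := Fintype.ofFinite _

noncomputable instance (l : P → P) (T : P → Prop) : DecidableEq (NeatTop l T) := Classical.decEq _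

noncomputable instance (l : P → P) (y : P) : DecidableEq {L : List P // IsNeatList l y L} :=
  Classical.decEq _

variable {R : Type*} [CommRing R]

theorem listExt_mem {l : P → P} {y : P} {L : List P} (hL : IsNeatList l y L) :
    listExt R L ∈ flagSpace R y := by
  induction hL with
  | nil => exact Submodule.subset_span .one
  | cons hc _ _ ih =>
    rw [listExt, List.map_cons, List.prod_cons]
    exact atomExt_mul_mem hc ih

theorem card_neatTop (l : P → P) (T : P → Prop) [DecidablePred T] :
    Fintype.card (NeatTop l T) = ∑ y : P with T y, neatCount l y := by
  rw [Finset.sum_subtype _ (p := T) (F := Subtype.fintype T) (by simp) (neatCount l), ← Nat.card_eq_fintype_card,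
    Nat.card_sigma]
  simp only [Nat.card_eq_fintype_card, neatCount]

/-- The Gram determinant of the neat chains with top `y`. -/
noncomputable def neatDet (w : P → R) (l : P → P) (y : P) : R :=
  gramDet (atomForm w) (fun L : {L : List P // IsNeatList l y L} => listExt R L.1)

variable [GeometricBouquet P]

theorem gramDet_neatTop (w : P → R) (l : P → P) (T : P → Prop) [DecidablePred T] :
    gramDet (atomForm w) (fun a : NeatTop l T => listExt R a.2.1) =
      ∏ y : P with T y, neatDet w l y := by
  classical
  rw [Finset.prod_subtype _ (p := T) (F := Subtype.fintype T) (by simp) (neatDet w l)]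
  trans
  swap
  · refine gramDet_sigma (atomForm w) (fun a : NeatTop l T => listExt R a.2.1) fun a b hab => ?_
    exact gramForm_listExt_of_ne w a.2.2 b.2.2 fun h => hab (Subtype.ext h)
  · unfold gramDet
    congr!

variable {l : P → P} (hl : IsAtomLabeling l)

include hl in
-- Straightening with `e = l y` at every level leaves only neat flags.
theorem flagSpace_le_span_neat (y : P) :
    flagSpace R y ≤
      Submodule.span R (Set.range fun L : {L : List P // IsNeatList l y L} => listExt R L.1) := by
  induction hn : rk y using Nat.strong_induction_on generalizing y with
  | _ n ih =>
  subst hn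
  by_cases hy : y = ⊥
  · subst hy
    refine Submodule.span_le.2 ?_
    rintro _ (_ | ⟨h, _⟩)
    · exact Submodule.subset_span ⟨⟨[], .nil⟩, by simp [listExt]⟩
    · exact absurd h not_covBy_bot
  · refine (flagSpace_le_span (hl y hy).1 (hl y hy).2).trans (Submodule.span_le.2 ?_)
    rintro _ ⟨h, k, h1, h2, hk, rfl⟩
    have hk' := ih _ (rk_lt h1.lt) h rfl hk
    clear hk
    change _ ∈ Submodule.span R _
    induction hk' using Submodule.span_induction with
    | zero => rw [mul_zero]; exact zero_mem _
    | add a b _ _ ha hb => rw [mul_add]; exact add_mem ha hb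
    | smul r a _ ha => rw [mul_smul_comm]; exact Submodule.smul_mem _ _ ha
    | mem k hk =>
      obtain ⟨L, rfl⟩ := hk
      exact Submodule.subset_span ⟨⟨y :: L.1, .cons h1 h2 L.2⟩, by simp [listExt]⟩

variable {x e : P} (he : IsAtom e) (hex : e ≤ x)

/-- The elements of `[⊥, x]` of rank `p - 1` that do not lie above `e`. -/
def CoTop (x e : P) (p : ℕ) (y : P) : Prop := y ≤ x ∧ rk y + 1 = p ∧ ¬ e ≤ y

variable (R) in
/-- The neat chains of length `p - 1` avoiding `e`, extended by `x`. -/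
noncomputable def coneFam (l : P → P) (x e : P) (p : ℕ) (a : NeatTop l (CoTop x e p)) :
    ExteriorAlgebra R ({a : P // IsAtom a} → R) := atomExt R x * listExt R a.2.1

include hl in
theorem mul_mem_span_coneFam {p : ℕ} {y : P} (hy : CoTop x e p y)
    {k : ExteriorAlgebra R ({a : P // IsAtom a} → R)} (hk : k ∈ flagSpace R y) :
    atomExt R x * k ∈ Submodule.span R (Set.range (coneFam R l x e p)) := by
  have hk' := flagSpace_le_span_neat hl y hk
  clear hk
  induction hk' using Submodule.span_induction with
  | zero => rw [mul_zero]; exact zero_mem _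
  | add a b _ _ ha hb => rw [mul_add]; exact add_mem ha hb
  | smul r a _ ha => rw [mul_smul_comm]; exact Submodule.smul_mem _ _ ha
  | mem k hk =>
    obtain ⟨L, rfl⟩ := hk
    exact Submodule.subset_span ⟨⟨⟨y, hy⟩, L⟩, rfl⟩

include hl he hex in
theorem mul_mem_span_coneFam' {p : ℕ} {y : P} (hyx : y ≤ x) (hp : rk y + 1 = p)
    {k : ExteriorAlgebra R ({a : P // IsAtom a} → R)} (hk : k ∈ flagSpace R y) :
    atomExt R x * k ∈ Submodule.span R (Set.range (coneFam R l x e p)) := by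
  refine Submodule.span_le.2 ?_ (atomExt_mul_mem_span he hex hyx hk)
  rintro _ ⟨h, k', h1, h2, h3, h4, rfl⟩
  exact mul_mem_span_coneFam hl ⟨h1, by rw [h2, hp], h3⟩ h4

include hl he hex in
-- Chains whose top lies above `e` are counted by the coatoms of the top avoiding `e`, one rank
-- lower. This gives the two spanning families of rank level `p` the same size.
theorem card_neatTop_eq (p : ℕ) :
    Fintype.card (NeatTop l fun y => y ≤ x ∧ rk y = p) =
      Fintype.card (NeatTop l (CoTop x e p)) + Fintype.card (NeatTop l (CoTop x e (p + 1))) := by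
  classical
  simp only [card_neatTop]
  rw [← Finset.sum_filter_add_sum_filter_not _ (fun y => e ≤ y)]
  congr 1
  · have h := sum_cover (bot_covBy_iff.2 he) hex fun h => if rk h + 1 = p then neatCount l h else 0
    simp only [bot_le, true_and] at h
    rw [← Finset.sum_filter, filter_filter] at h
    trans ∑ h ∈ univ.filter (fun h => (h ≤ x ∧ ¬ e ≤ h) ∧ rk h + 1 = p), neatCount l h
    · rw [← h, ← Finset.sum_filter_add_sum_filter_not (univ.filter fun z => e ≤ z ∧ z ≤ x)
        (fun y => rk y = p)]
      rw [Finset.sum_eq_zero (s := filter (fun y => ¬ rk y = p) _), add_zero, filter_filter]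
      · refine Finset.sum_congr (by ext; simp; tauto) fun z hz => ?_
        simp only [mem_filter, mem_univ, true_and] at hz
        rw [neatCount_eq_sum_of_isAtom hl he hz.1.1]
        refine Finset.sum_congr rfl fun y hy => ?_
        simp only [mem_filter, mem_univ, true_and] at hy
        rw [if_pos]
        rw [← rk_covBy hy.1, hz.2]
      · intro z hz
        simp only [mem_filter, mem_univ, true_and] at hz
        refine Finset.sum_eq_zero fun y hy => ?_
        simp only [mem_filter, mem_univ, true_and] at hy
        rw [if_neg]
        rw [← rk_covBy hy.1]
        exact hz.2
    · refine Finset.sum_congr (Finset.ext fun h => ⟨fun hh => mem_filter.2 ⟨mem_univ _, ?_⟩,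
        fun hh => mem_filter.2 ⟨mem_univ _, ?_⟩⟩) fun _ _ => rfl
      · have := (mem_filter.1 hh).2
        exact ⟨this.1.1, this.2, this.1.2⟩
      · have := (mem_filter.1 hh).2
        exact ⟨⟨this.1, this.2.2⟩, this.2.1⟩
  · refine Finset.sum_congr (Finset.ext fun h => ⟨fun hh => mem_filter.2 ⟨mem_univ _, ?_⟩,
      fun hh => mem_filter.2 ⟨mem_filter.2 ⟨mem_univ _, ?_⟩, ?_⟩⟩) fun _ _ => rfl
    · have h1 := (mem_filter.1 (mem_filter.1 hh).1).2
      exact ⟨h1.1, by rw [h1.2], (mem_filter.1 hh).2⟩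
    · have := (mem_filter.1 hh).2
      exact ⟨this.1, Nat.add_right_cancel this.2.1⟩
    · exact (mem_filter.1 hh).2.2.2

include hl he hex in
open Classical in
/-- The recursion for the Gram determinants of the cones over the rank levels. -/
theorem gramDet_coneFam_mul [IsDomain R] (hR : ∀ u : R, IsUnit u → u * u = 1) (w : P → R) (p : ℕ) :
    gramDet (atomForm w) (coneFam R l x e p) * gramDet (atomForm w) (coneFam R l x e (p + 1)) =
      atomWeight w x ^ Fintype.card (NeatTop l (CoTop x e (p + 1))) *
        ∏ y : P with y ≤ x ∧ rk y = p, neatDet w l y := by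
  rw [← atomForm_atomVec]
  -- Here `z` consists of the cones of degree `p`, killed by `x`, and `u` of the neat chains of
  -- length `p` with top avoiding `e`; multiplying `u` by `x` gives the cones of degree `p + 1`.
  have h1 := gramDet_mul_gramDet (atomForm w) (atomVec R x) (coneFam R l x e p)
    (fun a : NeatTop l (CoTop x e (p + 1)) => listExt R a.2.1)
    (fun a => atomExt_mul_self _ _) ?_
  · refine h1.trans ?_
    congr 1
    rw [← gramDet_neatTop]
    -- Cones and chains avoiding `e` together span the same module as all neat chains of length `p`
    -- in `[⊥, x]`.
    refine (gramDet_eq_of_span _ hR (Fintype.equivOfCardEq ?_) ?_ ?_).symm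
    · rw [Fintype.card_sum, card_neatTop_eq hl he hex]
    · rintro (a | a)
      · change atomExt R x * listExt R a.2.1 ∈ _
        rw [atomExt_mul_eq_sum a.1.2.1 (listExt_mem a.2.2)]
        refine sum_mem fun z hz => ?_
        simp only [mem_filter, mem_univ, true_and] at hz
        have hz2 : z ≤ x ∧ rk z = p := ⟨hz.2, by rw [rk_covBy hz.1, a.1.2.2.1]⟩
        refine Submodule.span_mono ?_
          (flagSpace_le_span_neat hl z (atomExt_mul_mem hz.1 (listExt_mem a.2.2)))
        rintro _ ⟨L, rfl⟩
        exact ⟨⟨⟨z, hz2⟩, L⟩, rfl⟩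
      · exact Submodule.subset_span ⟨⟨⟨a.1.1, a.1.2.1, by have := a.1.2.2.1; omega⟩, a.2⟩, rfl⟩
    · have hU : ∀ {y : P} {k}, y ≤ x → rk y = p → ¬ e ≤ y → k ∈ flagSpace R y →
          k ∈ Submodule.span R (Set.range (Sum.elim (coneFam R l x e p)
            (fun a : NeatTop l (CoTop x e (p + 1)) => listExt R a.2.1))) := by
        intro y k h1 h2 h3 hk
        refine Submodule.span_mono ?_ (flagSpace_le_span_neat hl y hk)
        rintro _ ⟨L, rfl⟩
        exact ⟨Sum.inr ⟨⟨y, h1, by rw [h2], h3⟩, L⟩, rfl⟩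
      rintro ⟨⟨y, hyx, hyp⟩, L⟩
      by_cases hey : e ≤ y
      swap
      · exact hU hyx hyp hey (listExt_mem L.2)
      refine Submodule.span_le.2 ?_ (flagSpace_le_span he hey (listExt_mem L.2))
      rintro _ ⟨h, k, hc, h2, hk, rfl⟩
      -- A flag whose top lies above `e` is a cone minus flags with tops avoiding `e`.
      rw [atomExt_mul_eq_sub hc hyx hk]
      refine sub_mem ?_ (sum_mem fun z hz => ?_)
      · refine Submodule.span_mono ?_ (mul_mem_span_coneFam hl (x := x) (e := e) (p := p)
          ⟨hc.le.trans hyx, by rw [← rk_covBy hc, hyp], h2⟩ hk)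
        rintro _ ⟨a, rfl⟩
        exact ⟨Sum.inl a, rfl⟩
      · simp only [mem_sdiff, mem_filter, mem_univ, true_and, mem_singleton] at hz
        exact hU hz.1.2 (by rw [rk_covBy hz.1.1, ← rk_covBy hc, hyp])
          (fun hez => hz.2 (cover_unique h2 hz.1.1 hez hc hey)) (atomExt_mul_mem hz.1.1 hk)
  · intro a
    have hmem := contractLeft_mem (atomForm w (atomVec R x)) (listExt_mem (R := R) a.2.2)
    refine Submodule.iSup_induction _
      (motive := fun m => atomExt R x * m ∈ Submodule.span R (Set.range (coneFam R l x e p)))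
      hmem ?_ ?_ ?_
    · intro h k hk
      refine mul_mem_span_coneFam' hl he hex (h.2.le.trans a.1.2.1) ?_ hk
      have := rk_covBy h.2
      have := a.1.2.2.1
      omega
    · rw [mul_zero]; exact zero_mem _
    · intro a b ha hb
      rw [mul_add]; exact add_mem ha hb

theorem gramDet_coneFam_zero (w : P → R) : gramDet (atomForm w) (coneFam R l x e 0) = 1 := by
  have : IsEmpty (NeatTop l (CoTop x e 0)) := ⟨fun a => by have := a.1.2.2.1; omega⟩
  exact Matrix.det_isEmpty

/-- At the last level the admissible tops are the coatoms of `x` not above `l x`, so the cones are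
the neat chains with top `x`. -/
theorem gramDet_coneFam_rk (w : P → R) (hx : x ≠ ⊥) :
    gramDet (atomForm w) (coneFam R l x (l x) (rk x)) = neatDet w l x := by
  have hT : (fun h => h ⋖ x ∧ ¬ l x ≤ h) = CoTop x (l x) (rk x) := by
    funext h
    exact propext ⟨fun h' => ⟨h'.1.le, (rk_covBy h'.1).symm, h'.2⟩,
      fun h' => ⟨covBy_of_rk h'.1 h'.2.1.symm, h'.2.2⟩⟩
  have h1 : ∀ T : P → Prop, T = CoTop x (l x) (rk x) →
      gramDet (atomForm w) (coneFam R l x (l x) (rk x)) =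
        gramDet (atomForm w) fun a : NeatTop l T => atomExt R x * listExt R a.2.1 := by
    rintro _ rfl
    rfl
  rw [h1 _ hT, ← gramDet_comp_equiv (atomForm w) (neatListEquiv l hx), neatDet]
  congr 1
  funext L
  obtain ⟨a, rfl⟩ := (neatListEquiv l hx).symm.surjective L
  rw [Function.comp_apply, Equiv.apply_symm_apply]
  change _ = listExt R (x :: a.2.1)
  simp [listExt]

end families

end GeometricBouquet

/-! ### Solving the recursion in a field. -/

theorem zpow_sum_of_ne_zero {K ι : Type*} [Field K] {a : K} (ha : a ≠ 0) (s : Finset ι) (f : ι → ℤ) :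
    a ^ (∑ i ∈ s, f i) = ∏ i ∈ s, a ^ f i := by
  classical
  induction s using Finset.induction_on with
  | empty => simp
  | insert i s hi ih => rw [Finset.sum_insert hi, Finset.prod_insert hi, zpow_add₀ ha, ih]

theorem eq_prod_of_mul_succ_eq {K : Type*} [Field K] {z A : ℕ → K} {r : ℕ} (h0 : z 0 = 1)
    (hz : ∀ p < r, z p * z (p + 1) = A p) (hA : ∀ p < r, A p ≠ 0) :
    z r = ∏ p ∈ range r, A p ^ ((-1) ^ (r + 1 + p) : ℤ) := by
  induction r with
  | zero => simpa using h0
  | succ r ih =>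
    have h1 := ih (fun p hp => hz p (hp.trans (Nat.lt_succ_self r)))
      (fun p hp => hA p (hp.trans (Nat.lt_succ_self r)))
    have h2 := hz r (Nat.lt_succ_self r)
    have h3 : z r ≠ 0 := by
      intro h
      rw [h, zero_mul] at h2
      exact hA r (Nat.lt_succ_self r) h2.symm
    rw [Finset.prod_range_succ]
    have h4 : ((-1) ^ (r + 1 + 1 + r) : ℤ) = 1 := Even.neg_one_pow ⟨r + 1, by ring⟩
    have h5 : ∏ p ∈ range r, A p ^ ((-1) ^ (r + 1 + 1 + p) : ℤ) = (z r)⁻¹ := by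
      rw [h1, ← Finset.prod_inv_distrib]
      refine Finset.prod_congr rfl fun p _ => ?_
      rw [← zpow_neg]
      congr 1
      ring
    rw [h4, h5, zpow_one, ← h2]
    field_simp

namespace GeometricBouquet

variable {P : Type*} [PartialOrder P] [OrderBot P] [Fintype P]
variable {R : Type*} [CommRing R]

open Classical

theorem neatDet_bot (w : P → R) (l : P → P) : neatDet w l ⊥ = 1 := by
  have h : Fintype.card {L : List P // IsNeatList l ⊥ L} = 1 := neatCount_bot l
  rw [neatDet, gramDet, Matrix.det_eq_elem_of_card_eq_one h ⟨[], .nil⟩]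
  simp [listExt, gramForm_one]

variable [GeometricBouquet P] {l : P → P} (hl : IsAtomLabeling l)

include hl in
-- Crapo's formula for the atom `l x`, sorted by rank.
theorem sum_card_neatTop {x : P} (hx : x ≠ ⊥) :
    ∑ p ∈ range (rk x), ((-1) ^ (rk x + 1 + p) : ℤ) *
      Fintype.card (NeatTop l (CoTop x (l x) (p + 1))) = crapoBeta x := by
  have h1 := Finset.sum_fiberwise_of_maps_to (s := univ.filter fun y => y ≤ x ∧ ¬ l x ≤ y)
    (t := range (rk x)) (g := rk) (fun y hy => by
      simp only [mem_filter, mem_univ, true_and] at hy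
      rw [mem_range]
      refine rk_lt (lt_of_le_of_ne hy.1 ?_)
      rintro rfl
      exact hy.2 (hl y hx).2) (fun y => (-1) ^ rk x * - moebius ⊥ y)
  rw [crapoBeta_eq (hl x hx).1 (hl x hx).2, ← Finset.sum_neg_distrib, Finset.mul_sum, ← h1]
  refine Finset.sum_congr rfl fun p _ => ?_
  rw [card_neatTop, Nat.cast_sum, Finset.mul_sum, filter_filter]
  refine Finset.sum_congr (Finset.ext fun h => ?_) fun y hy => ?_
  · simp only [mem_filter, mem_univ, true_and, CoTop, Nat.add_right_cancel_iff]
    tauto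
  · have hy' : rk y = p := (mem_filter.1 hy).2.2
    rw [neatCount_eq hl, ← hy', ← mul_assoc, ← pow_add,
      show rk x + 1 + rk y + rk y = rk x + 1 + 2 * rk y by ring, pow_add, pow_mul]
    ring

variable {K : Type*} [Field K] (f : R →+* K)

include hl in
theorem neatDet_eq_mul_prod [IsDomain R] (hR : ∀ u : R, IsUnit u → u * u = 1)
    (hf : Function.Injective f) (w : P → R) {x : P} (hx : x ≠ ⊥) (hw : atomWeight w x ≠ 0)
    (hD : ∀ y < x, neatDet w l y ≠ 0) :
    f (neatDet w l x) = f (atomWeight w x) ^ crapoBeta x *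
      ∏ y : P with y < x, f (neatDet w l y) ^ ((-1) ^ (rk x + 1 + rk y) : ℤ) := by
  have hw' : f (atomWeight w x) ≠ 0 := (map_ne_zero_iff f hf).2 hw
  have h1 := eq_prod_of_mul_succ_eq (r := rk x)
    (z := fun p => f (gramDet (atomForm w) (coneFam R l x (l x) p)))
    (A := fun p => f (atomWeight w x ^ Fintype.card (NeatTop l (CoTop x (l x) (p + 1))) *
        ∏ y : P with y ≤ x ∧ rk y = p, neatDet w l y))
    (by simp only [gramDet_coneFam_zero, map_one])
    (fun p _ => by
      rw [← map_mul, gramDet_coneFam_mul hl (hl x hx).1 (hl x hx).2 hR])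
    (fun p hp => (map_ne_zero_iff f hf).2 (mul_ne_zero (pow_ne_zero _ hw)
      (Finset.prod_ne_zero_iff.2 fun y hy => hD _ (lt_of_le_of_ne (mem_filter.1 hy).2.1 fun h => by
        have := (mem_filter.1 hy).2.2
        rw [h] at this
        omega))))
  simp only [gramDet_coneFam_rk w hx] at h1
  rw [h1]
  simp only [map_mul, map_pow, map_prod, mul_zpow, Finset.prod_mul_distrib]
  congr 1
  · rw [← sum_card_neatTop hl hx, zpow_sum_of_ne_zero hw']
    refine Finset.prod_congr rfl fun p _ => ?_
    rw [← zpow_natCast, ← zpow_mul, mul_comm]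
  · rw [← Finset.prod_fiberwise_of_maps_to (s := univ.filter fun y => y < x) (t := range (rk x))
      (g := rk) (fun y hy => mem_range.2 (rk_lt (mem_filter.1 hy).2))]
    refine Finset.prod_congr rfl fun p hp => ?_
    rw [← Finset.prod_zpow, filter_filter]
    refine Finset.prod_congr (Finset.ext fun y => ?_) fun y hy => ?_
    · simp only [mem_filter, mem_univ, true_and]
      refine ⟨fun h => ⟨lt_of_le_of_ne h.1 ?_, h.2⟩, fun h => ⟨h.1.le, h.2⟩⟩
      rintro rfl
      have := mem_range.1 hp
      omega
    · rw [(mem_filter.1 hy).2.2]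

/-- The defining recursion of `μ(u, ·)` with the alternating signs inserted. -/
theorem sum_abs_moebius {u x : P} (hux : u < x) :
    ∑ y : P with u ≤ y ∧ y < x, ((-1) ^ (rk x + 1 + rk y) : ℤ) * |moebius u y| = |moebius u x| := by
  have h0 := sum_moebius u x
  rw [if_neg hux.ne] at h0
  have h1 : (univ.filter fun y => u ≤ y ∧ y ≤ x) =
      insert x (univ.filter fun y => u ≤ y ∧ y < x) := by
    ext y
    simp only [mem_filter, mem_univ, true_and, mem_insert]
    constructor
    · rintro ⟨h1, h2⟩
      rcases h2.eq_or_lt with h | h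
      · exact .inl h
      · exact .inr ⟨h1, h⟩
    · rintro (rfl | ⟨h1, h2⟩)
      · exact ⟨hux.le, le_rfl⟩
      · exact ⟨h1, h2.le⟩
  rw [h1, Finset.sum_insert (by simp)] at h0
  rw [abs_moebius hux.le, eq_neg_of_add_eq_zero_left h0, ← Finset.sum_neg_distrib, Finset.mul_sum]
  refine Finset.sum_congr rfl fun y hy => ?_
  rw [abs_moebius (mem_filter.1 hy).2.1, ← mul_assoc, ← pow_add,
    show rk x + 1 + rk y + (rk u + rk y) = rk u + rk x + 1 + 2 * rk y by ring, pow_add, pow_mul,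
    pow_succ]
  ring

include hl in
/-- The Gram determinant of the neat chains with top `x`, in a field containing the weights. -/
theorem neatDet_eq_prod [IsDomain R] (hR : ∀ u : R, IsUnit u → u * u = 1)
    (hf : Function.Injective f) (w : P → R) {x : P}
    (hw : ∀ y ≤ x, y ≠ ⊥ → atomWeight w y ≠ 0) :
    f (neatDet w l x) =
      ∏ u : P with u ≤ x ∧ u ≠ ⊥, f (atomWeight w u) ^ (crapoBeta u * |moebius u x|) := by
  induction hn : rk x using Nat.strong_induction_on generalizing x with
  | _ n ih =>
  subst hn
  by_cases hx : x = ⊥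
  · subst hx
    rw [neatDet_bot, map_one, Finset.prod_eq_one]
    intro u hu
    have := (mem_filter.1 hu).2
    exact absurd (le_bot_iff.1 this.1) this.2
  have hfw : ∀ y ≤ x, y ≠ ⊥ → f (atomWeight w y) ≠ 0 := fun y h1 h2 =>
    (map_ne_zero_iff f hf).2 (hw y h1 h2)
  have ih' : ∀ y < x, f (neatDet w l y) =
      ∏ u : P with u ≤ y ∧ u ≠ ⊥, f (atomWeight w u) ^ (crapoBeta u * |moebius u y|) :=
    fun y hy => ih _ (rk_lt hy) (fun z hz => hw z (hz.trans hy.le)) rfl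
  have hD : ∀ y < x, neatDet w l y ≠ 0 := by
    intro y hy
    rw [← map_ne_zero_iff f hf, ih' y hy]
    refine Finset.prod_ne_zero_iff.2 fun u hu => zpow_ne_zero _ (hfw u ?_ (mem_filter.1 hu).2.2)
    exact (mem_filter.1 hu).2.1.trans hy.le
  rw [neatDet_eq_mul_prod hl f hR hf w hx (hw x le_rfl hx) hD]
  have h1 : (univ.filter fun u => u ≤ x ∧ u ≠ ⊥) =
      insert x (univ.filter fun u => u < x ∧ u ≠ ⊥) := by
    ext y
    simp only [mem_filter, mem_univ, true_and, mem_insert]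
    constructor
    · rintro ⟨h1, h2⟩
      rcases h1.eq_or_lt with h | h
      · exact .inl h
      · exact .inr ⟨h, h2⟩
    · rintro (rfl | ⟨h1, h2⟩)
      · exact ⟨le_rfl, hx⟩
      · exact ⟨h1.le, h2⟩
  rw [h1, Finset.prod_insert (by simp), moebius_self, abs_one, mul_one]
  congr 1
  -- After exchanging the products, the exponents of a fixed `u` add up over `u ≤ y < x` to
  -- `β(u)|μ(u, x)|`.
  trans ∏ y : P with y < x, ∏ u : P with u ≤ y ∧ u ≠ ⊥,
      f (atomWeight w u) ^ (crapoBeta u * (((-1) ^ (rk x + 1 + rk y) : ℤ) * |moebius u y|))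
  · refine Finset.prod_congr rfl fun y hy => ?_
    rw [ih' y (mem_filter.1 hy).2, ← Finset.prod_zpow]
    refine Finset.prod_congr rfl fun u _ => ?_
    rw [← zpow_mul]
    congr 1
    ring
  · rw [Finset.prod_comm' (t' := univ.filter fun u => u < x ∧ u ≠ ⊥)
      (s' := fun u => univ.filter fun y => u ≤ y ∧ y < x)]
    · refine Finset.prod_congr rfl fun u hu => ?_
      have hu' := (mem_filter.1 hu).2
      rw [← sum_abs_moebius hu'.1, Finset.mul_sum, zpow_sum_of_ne_zero (hfw u hu'.1.le hu'.2)]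
    · intro y u
      simp only [mem_filter, mem_univ, true_and]
      exact ⟨fun h => ⟨⟨h.2.1, h.1⟩, h.2.1.trans_lt h.1, h.2.2⟩, fun h => ⟨h.1.2, h.1.1, h.2.2⟩⟩

/-! ### Nonnegativity of the beta function. -/

theorem atomWeight_ite (e y : P) (he : IsAtom e) (c : ℤ) :
    atomWeight (fun a => if a = e then c + 1 else 1) y =
      Fintype.card {a : {a : P // IsAtom a} // a.1 ≤ y} + if e ≤ y then c else 0 := by
  have h : ∀ a : {a : P // IsAtom a}, (if a.1 ≤ y then (if a.1 = e then c + 1 else 1) else 0 : ℤ) =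
      (if a.1 ≤ y then 1 else 0) + if a = ⟨e, he⟩ then (if e ≤ y then c else 0) else 0 := by
    rintro ⟨a, ha⟩
    simp only [Subtype.mk.injEq]
    by_cases hae : a = e
    · subst hae
      split_ifs <;> simp [add_comm]
    · simp [hae]
  unfold atomWeight
  rw [Finset.sum_congr rfl fun a _ => h a, Finset.sum_add_distrib, Finset.sum_ite_eq' univ,
    if_pos (mem_univ _), Fintype.card_subtype]
  simp

theorem crapoBeta_bot : crapoBeta (⊥ : P) = 0 := by
  unfold crapoBeta
  refine mul_eq_zero_of_right _ (Finset.sum_eq_zero fun y hy => ?_)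
  rw [le_bot_iff.1 (mem_filter.1 hy).2, rk_bot]
  simp

include hl in
/-- Crapo's beta function is nonnegative: it is the exponent of a prime in an integer. -/
theorem crapoBeta_nonneg (x : P) : 0 ≤ crapoBeta x := by
  by_cases hx : x = ⊥
  · subst hx
    exact crapoBeta_bot.ge
  obtain ⟨he, hex⟩ := hl x hx
  set e := l x
  set N : P → ℕ := fun y => Fintype.card {a : {a : P // IsAtom a} // a.1 ≤ y} with hN
  obtain ⟨p, hp1, hp⟩ := Nat.exists_infinite_primes (N x + 1)
  have : Fact p.Prime := ⟨hp⟩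
  -- All atoms have weight 1 except `e`, whose weight makes the total below `x` equal to `p`.
  set w : P → ℤ := fun a => if a = e then ((p : ℤ) - N x) + 1 else 1
  have hW : ∀ y, atomWeight w y = N y + if e ≤ y then ((p : ℤ) - N x) else 0 := fun y =>
    atomWeight_ite e y he _
  have hWx : atomWeight w x = p := by rw [hW, if_pos hex]; ring
  have hdvd : ∀ y < x, y ≠ ⊥ → ¬ (p : ℤ) ∣ atomWeight w y := by
    intro y hy hb hd
    have h1 : 0 < N y := by
      obtain ⟨a, ha, hay, -⟩ := exists_atom (bot_lt_iff_ne_bot.2 hb)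
      exact Fintype.card_pos_iff.2 ⟨⟨⟨a, ha⟩, hay⟩⟩
    have h2 : N y < N x := by
      obtain ⟨a, ha, hax, hay⟩ := exists_atom hy
      refine Fintype.card_lt_of_injective_of_notMem
        (fun b : {a : {a : P // IsAtom a} // a.1 ≤ y} =>
          (⟨b.1, b.2.trans hy.le⟩ : {a : {a : P // IsAtom a} // a.1 ≤ x}))
        (fun b c h => Subtype.ext (Subtype.mk.inj h)) (b := ⟨⟨a, ha⟩, hax⟩) ?_
      rintro ⟨b, hb⟩
      exact hay ((congrArg (fun c => c.1.1) hb : b.1.1 = a) ▸ b.2)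
    -- The weight of `y` is `N y` or `p - (N x - N y)`, and both `N y` and `N x - N y` lie strictly
    -- between 0 and `p`.
    rw [hW] at hd
    split_ifs at hd
    · have h3 : (p : ℤ) ∣ (N x : ℤ) - N y := by
        have := dvd_sub (dvd_refl (p : ℤ)) hd
        rwa [show (p : ℤ) - (N y + (p - N x)) = N x - N y by ring] at this
      have := Int.le_of_dvd (by omega) h3
      omega
    · rw [add_zero] at hd
      have := Int.le_of_dvd (by omega) hd
      omega
  have hne : ∀ y ≤ x, y ≠ ⊥ → atomWeight w y ≠ 0 := by
    intro y hy hb h0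
    rcases hy.eq_or_lt with rfl | hy
    · rw [hWx] at h0
      exact hp.ne_zero (by exact_mod_cast h0)
    · exact hdvd y hy hb (h0 ▸ dvd_zero _)
  have hu : ∀ u : ℤ, IsUnit u → u * u = 1 := fun u h => Int.isUnit_mul_self h
  have key := neatDet_eq_prod hl (Int.castRingHom ℚ) hu Int.cast_injective w hne
  rw [← Finset.mul_prod_erase _ _ (show x ∈ univ.filter (fun u => u ≤ x ∧ u ≠ ⊥) by simp [hx]),
    moebius_self, abs_one, mul_one, hWx] at key
  have hrest : ∏ u ∈ (univ.filter (fun u => u ≤ x ∧ u ≠ ⊥)).erase x,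
      Int.castRingHom ℚ (atomWeight w u) ^ (crapoBeta u * |moebius u x|) ≠ 0 ∧
      padicValRat p (∏ u ∈ (univ.filter (fun u => u ≤ x ∧ u ≠ ⊥)).erase x,
      Int.castRingHom ℚ (atomWeight w u) ^ (crapoBeta u * |moebius u x|)) = 0 := by
    refine Finset.prod_induction _ (fun q : ℚ => q ≠ 0 ∧ padicValRat p q = 0) ?_ ?_ ?_
    · rintro a b ⟨ha, ha'⟩ ⟨hb, hb'⟩
      exact ⟨mul_ne_zero ha hb, by rw [padicValRat.mul ha hb, ha', hb', add_zero]⟩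
    · simp
    · intro u hu
      simp only [mem_erase, mem_filter, mem_univ, true_and] at hu
      have h0 : (Int.castRingHom ℚ (atomWeight w u)) ≠ 0 := by
        simpa using hne u hu.2.1 hu.2.2
      refine ⟨zpow_ne_zero _ h0, ?_⟩
      rw [padicValRat.zpow, eq_intCast, padicValRat.of_int,
        padicValInt.eq_zero_of_not_dvd (hdvd u (lt_of_le_of_ne hu.2.1 hu.1) hu.2.2)]
      simp
  have hp0 : (p : ℚ) ≠ 0 := by exact_mod_cast hp.ne_zero
  -- On the left is the valuation of an integer, on the right `β(x)`.
  have h3 := congrArg (padicValRat p) key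
  simp only [eq_intCast, Int.cast_natCast] at h3 hrest
  rw [padicValRat.mul (zpow_ne_zero _ hp0) hrest.1, hrest.2, padicValRat.zpow,
    padicValRat.self hp.one_lt, padicValRat.of_int] at h3
  omega

end GeometricBouquet

/-! ### The chain matrix as a Gram matrix. -/

namespace GeometricBouquet

variable {P : Type*} [PartialOrder P] [OrderBot P] {l : P → P}

theorem isNeatSeq (C : NeatChain l) : IsNeatSeq l C.series.toFun :=
  ⟨C.head_eq, C.series.step, C.neat⟩

/-- Removes the cast in `Generates`, so that two chains of equal size can be compared over the same
`Fin k`. -/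
theorem exists_generates_iff (C : NeatChain l) {k : ℕ} (h : k = C.size) :
    ∃ c : Fin (k + 1) → P, IsNeatSeq l c ∧ descList c = descList C.series.toFun ∧
      ∀ a : Fin k → {x : P // IsAtom x}, Generates a C ↔
        ∀ i : Fin k, IsLUB ((fun j => (a j : P)) '' Set.Iic i) (c i.succ) := by
  subst h
  exact ⟨C.series.toFun, isNeatSeq C, rfl, fun a => ⟨fun ⟨_, h⟩ => h, fun h => ⟨rfl, h⟩⟩⟩

theorem descList_injective {C C' : NeatChain l}
    (h : descList C.series.toFun = descList C'.series.toFun) : C = C' := by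
  obtain ⟨⟨n, c, hc⟩, h0, h1, h2⟩ := C
  obtain ⟨⟨n', c', hc'⟩, h0', h1', h2'⟩ := C'
  obtain rfl : n = n' := by simpa [descList] using congrArg List.length h
  obtain rfl : c = c' := by
    funext i
    induction i using Fin.cases with
    | zero => exact h0.trans h0'.symm
    | succ i => simpa using congrFun (List.ofFn_injective h) i.rev
  rfl

variable [Fintype P]

/-- Neat chains in the two descriptions. -/
noncomputable def neatChainEquiv (l : P → P) : NeatChain l ≃ NeatTop l IsMax :=
  Equiv.ofBijective
    (fun C => ⟨⟨C.series.last, C.isMax_last⟩, descList C.series.toFun, (isNeatSeq C).isNeatList⟩) <| by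
    constructor
    · intro C C' h
      refine descList_injective ?_
      exact congrArg (fun a : NeatTop l IsMax => a.2.1) h
    · rintro ⟨⟨y, hy⟩, L, hL⟩
      obtain ⟨n, c, hc, rfl, rfl⟩ := hL.exists_seq
      exact ⟨⟨⟨n, c, hc.covBy⟩, hc.zero, hy, hc.neat⟩, rfl⟩

variable [GeometricBouquet P] {R : Type*} [CommRing R]

theorem chainMatrix_apply (w : P → R) (C C' : NeatChain l) :
    chainMatrix l w C C' = gramForm (atomForm w) (listExt R (descList C.series.toFun))
      (listExt R (descList C'.series.toFun)) := by
  classical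
  unfold chainMatrix
  rw [Matrix.of_apply]
  by_cases hk : C.size = C'.size
  · obtain ⟨c, hc, hd, hg⟩ := exists_generates_iff C rfl
    obtain ⟨c', hc', hd', hg'⟩ := exists_generates_iff C' hk
    rw [← hd, ← hd', gramForm_listExt_eq_sum w hc hc']
    refine Finset.sum_congr rfl fun a _ => Finset.sum_congr rfl fun σ _ => ?_
    refine if_congr (and_congr ?_ ?_) rfl rfl
    · rw [hg, hc.isLUB_iff]
    · rw [hg', hc'.isLUB_iff]
      rfl
  · rw [listExt_descList, listExt_descList, gramForm_ιMulti_of_ne (n := C.series.length) (m := C'.series.length) _ hk]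
    refine Finset.sum_eq_zero fun a _ => Finset.sum_eq_zero fun σ _ => if_neg ?_
    rintro ⟨-, h, -⟩
    exact hk h

open Classical in
theorem det_chainMatrix_eq_prod (w : P → R) :
    (chainMatrix l w).det = ∏ m : P with IsMax m, neatDet w l m := by
  rw [← gramDet_neatTop, gramDet, ← Matrix.det_submatrix_equiv_self (neatChainEquiv l)]
  congr 1
  ext C C'
  exact chainMatrix_apply w C C'

theorem cumulatedRho_nonneg (hl : IsAtomLabeling l) (x : P) : 0 ≤ cumulatedRho x :=
  mul_nonneg (crapoBeta_nonneg hl x) (Finset.sum_nonneg fun _ _ => abs_nonneg _)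

/-- The determinant of the chain matrix. -/
theorem det_chainMatrix (hl : IsAtomLabeling l) [IsDomain R]
    (hR : ∀ u : R, IsUnit u → u * u = 1) (w : P → R) (hw : ∀ y, y ≠ ⊥ → atomWeight w y ≠ 0) :
    (chainMatrix l w).det = ∏ x : P, atomWeight w x ^ (cumulatedRho x).toNat := by
  classical
  have hf : Function.Injective (algebraMap R (FractionRing R)) :=
    IsFractionRing.injective R (FractionRing R)
  apply hf
  rw [det_chainMatrix_eq_prod, map_prod, map_prod,
    Finset.prod_congr rfl fun m _ => neatDet_eq_prod hl _ hR hf w fun y _ => hw y,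
    Finset.prod_comm' (t' := univ.filter fun u => u ≠ ⊥)
      (s' := fun u => univ.filter fun m => IsMax m ∧ u ≤ m),
    ← Finset.prod_subset (Finset.filter_subset (fun u : P => u ≠ ⊥) univ)]
  · refine Finset.prod_congr rfl fun u hu => ?_
    have h0 := (map_ne_zero_iff _ hf).2 (hw u (mem_filter.1 hu).2)
    rw [← zpow_sum_of_ne_zero h0, ← Finset.mul_sum, map_pow, ← zpow_natCast,
      Int.toNat_of_nonneg (cumulatedRho_nonneg hl u)]
    rfl
  -- The weight of `⊥` is zero, but so is its exponent, and the factor is 1.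
  · intro u _ hu
    have : u = ⊥ := by simpa using hu
    rw [this, cumulatedRho, crapoBeta_bot]
    simp
  · intro m u
    simp only [mem_filter, mem_univ, true_and]
    tauto

end GeometricBouquet

/-! ### The flats of a bouquet of matroids. -/

namespace MatroidBouquet

variable {E : Type*} {𝓜 : MatroidBouquet E} {M N : Matroid E}

/-- If `e` in the closure were missing from `N.E`, axiom (iii) would make `insert e I` independent.
So `e` lies in `N.E`, and dependence of `insert e I` puts it into the closure there. -/
theorem IsMember.closure_subset_of_indep (hM : 𝓜.IsMember M) (hN : 𝓜.IsMember N) {I : Set E}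
    (hI : M.Indep I) (hIN : I ⊆ N.E) : M.closure I ⊆ N.closure I := by
  have hNI : N.Indep I := (hN.2 I).2 ⟨((hM.2 I).1 hI).1, hIN⟩
  intro e he
  have heM : e ∈ M.E := M.closure_subset_ground I he
  by_cases heI : e ∈ I
  · exact N.subset_closure I hIN heI
  have hdep : insert e I ∉ 𝓜.indep := fun h => by
    have h1 : M.Indep (insert e I) := (hM.2 _).2 ⟨h, Set.insert_subset heM hI.subset_ground⟩
    exact ((hI.insert_indep_iff_of_notMem heI).1 h1).2 he
  have heN : e ∈ N.E := by
    by_contra heN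
    exact hdep (𝓜.insert_mem _ hM.1 _ hN.1 I ((hM.2 I).1 hI).1 hI.subset_ground hIN e ⟨heM, heN⟩)
  by_contra hcl
  exact hdep ((hN.2 _).1 ((hNI.insert_indep_iff_of_notMem heI).2 ⟨heN, hcl⟩)).1

theorem IsMember.closure_subset (hM : 𝓜.IsMember M) (hN : 𝓜.IsMember N) {X : Set E}
    (hXM : X ⊆ M.E) (hXN : X ⊆ N.E) : M.closure X ⊆ N.closure X := by
  obtain ⟨I, hI⟩ := M.exists_isBasis X hXM
  rw [← hI.closure_eq_closure]
  exact (hM.closure_subset_of_indep hN hI.indep (hI.subset.trans hXN)).trans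
    (N.closure_subset_closure hI.subset)

/-- The closures of a set in different matroids of the bouquet agree. -/
theorem IsMember.closure_eq (hM : 𝓜.IsMember M) (hN : 𝓜.IsMember N) {X : Set E}
    (hXM : X ⊆ M.E) (hXN : X ⊆ N.E) : M.closure X = N.closure X :=
  (hM.closure_subset hN hXM hXN).antisymm (hN.closure_subset hM hXN hXM)

theorem IsMember.isFlat_of_le (hM : 𝓜.IsMember M) {x y : 𝓜.Flat} (hx : M.IsFlat x.1)
    (hyx : y ≤ x) : M.IsFlat y.1 := by
  obtain ⟨N, hN, hy⟩ := y.2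
  have h : y.1 ⊆ M.E := Set.Subset.trans hyx hx.subset_ground
  rw [Matroid.isFlat_iff_closure_eq, hM.closure_eq hN h hy.subset_ground, hy.closure]

theorem isFlat_inter (x y : 𝓜.Flat) : 𝓜.IsFlat (x.1 ∩ y.1) := by
  obtain ⟨M, hM, hx⟩ := x.2
  obtain ⟨N, hN, hy⟩ := y.2
  have h1 : x.1 ∩ y.1 ⊆ M.E := Set.inter_subset_left.trans hx.subset_ground
  have h2 : x.1 ∩ y.1 ⊆ N.E := Set.inter_subset_right.trans hy.subset_ground
  refine ⟨M, hM, Matroid.isFlat_iff_closure_eq.2 (Set.Subset.antisymm (Set.subset_inter ?_ ?_)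
    (M.subset_closure _ h1))⟩
  · exact (M.closure_subset_closure Set.inter_subset_left).trans hx.closure.subset
  · rw [hM.closure_eq hN h1 h2]
    exact (N.closure_subset_closure Set.inter_subset_right).trans hy.closure.subset

theorem IsMember.bot_eq (hM : 𝓜.IsMember M) : (⊥ : 𝓜.Flat).1 = M.loops :=
  (𝓜.loops_subset_loops 𝓜.exists_isMember.choose_spec hM).antisymm
    (𝓜.loops_subset_loops hM 𝓜.exists_isMember.choose_spec)

/-- The flat spanned by a set in one of the matroids of the bouquet. -/
def IsMember.closureFlat (hM : 𝓜.IsMember M) (X : Set E) : 𝓜.Flat :=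
  ⟨M.closure X, M, hM, M.isFlat_closure X⟩

theorem IsMember.mem_closureFlat_insert (hM : 𝓜.IsMember M) {x : 𝓜.Flat} {f : E}
    (hfM : f ∈ M.E) : f ∈ (hM.closureFlat (insert f x.1)).1 :=
  M.mem_closure_of_mem' (Set.mem_insert f _) hfM

theorem IsMember.closureFlat_insert_le (hM : 𝓜.IsMember M) {x y : 𝓜.Flat} (hy : M.IsFlat y.1)
    (hxy : x ≤ y) {f : E} (hf : f ∈ y.1) : hM.closureFlat (insert f x.1) ≤ y := by
  change M.closure (insert f x.1) ⊆ y.1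
  exact (M.closure_subset_closure (Set.insert_subset hf hxy)).trans hy.closure.subset

theorem IsMember.covBy_closureFlat_insert (hM : 𝓜.IsMember M) {x : 𝓜.Flat} (hx : M.IsFlat x.1)
    {f : E} (hfM : f ∈ M.E) (hf : f ∉ x.1) : x ⋖ hM.closureFlat (insert f x.1) := by
  have hle : x ≤ hM.closureFlat (insert f x.1) :=
    (Set.subset_insert f x.1).trans
      (M.subset_closure _ (Set.insert_subset hfM hx.subset_ground))
  refine ⟨lt_of_le_not_ge hle fun h => hf (h (hM.mem_closureFlat_insert hfM)), fun t hxt hlt => ?_⟩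
  have ht : M.IsFlat t.1 := hM.isFlat_of_le (M.isFlat_closure _) hlt.le
  obtain ⟨g, hgt, hgx⟩ := Set.not_subset.1 hxt.not_ge
  -- By the exchange property, adding `g` to `x` spans as much as adding `f`.
  have h1 : g ∈ M.closure (insert f x.1) \ M.closure x.1 := ⟨hlt.le hgt, by rwa [hx.closure]⟩
  refine hlt.not_ge ?_
  have h2 := hM.closureFlat_insert_le ht hxt.le hgt
  change M.closure (insert g x.1) ⊆ t.1 at h2
  rw [Matroid.closure_insert_congr h1] at h2
  exact h2

theorem exists_isMember_isFlat (x : 𝓜.Flat) : ∃ M, 𝓜.IsMember M ∧ M.IsFlat x.1 := x.2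

theorem IsMember.eRk_covBy (hM : 𝓜.IsMember M) {x y : 𝓜.Flat} (hy : M.IsFlat y.1)
    (hxy : x ⋖ y) : M.eRk y.1 = M.eRk x.1 + 1 := by
  have hx : M.IsFlat x.1 := hM.isFlat_of_le hy hxy.le
  obtain ⟨f, hfy, hfx⟩ := Set.not_subset.1 hxy.lt.not_ge
  have hfM : f ∈ M.E := hy.subset_ground hfy
  have hc := hM.covBy_closureFlat_insert hx hfM hfx
  have heq : hM.closureFlat (insert f x.1) = y :=
    (hxy.eq_or_eq hc.le (hM.closureFlat_insert_le hy hxy.le hfy)).resolve_left hc.lt.ne'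
  obtain ⟨I, hI⟩ := M.exists_isBasis x.1 hx.subset_ground
  have hfI : f ∉ M.closure I := by rwa [hI.closure_eq_closure, hx.closure]
  have h1 := hI.insert_isBasis_insert_of_notMem_closure hfI hfM
  rw [← heq]
  change M.eRk (M.closure (insert f x.1)) = _
  rw [M.eRk_closure_eq, h1.eRk_eq_encard, hI.eRk_eq_encard,
    Set.encard_insert_of_notMem fun h => hfx (hI.subset h)]

theorem exists_atom_mem (hM : 𝓜.IsMember M) {x : 𝓜.Flat} (hx : M.IsFlat x.1) {f : E}
    (hfx : f ∈ x.1) (hf : f ∉ (⊥ : 𝓜.Flat).1) : ∃ e : 𝓜.Flat, IsAtom e ∧ e ≤ x ∧ f ∈ e.1 :=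
  ⟨hM.closureFlat (insert f (⊥ : 𝓜.Flat).1),
    bot_covBy_iff.1 (hM.covBy_closureFlat_insert (hM.isFlat_of_le hx bot_le)
      (hx.subset_ground hfx) hf),
    hM.closureFlat_insert_le hx bot_le hfx, hM.mem_closureFlat_insert (hx.subset_ground hfx)⟩

/-- The intersection of `e` and `z` is a flat containing a nonloop, hence equals the atom `e`. In
particular a nonloop lies in at most one atom. -/
theorem atom_le {e z : 𝓜.Flat} (he : IsAtom e) {f : E} (hfe : f ∈ e.1) (hfz : f ∈ z.1)
    (hf : f ∉ (⊥ : 𝓜.Flat).1) : e ≤ z := by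
  let m : 𝓜.Flat := ⟨e.1 ∩ z.1, isFlat_inter e z⟩
  have hme : m ≤ e := Set.inter_subset_left
  rcases he.le_iff.1 hme with h | h
  · have : f ∈ m.1 := ⟨hfe, hfz⟩
    rw [h] at this
    exact absurd this hf
  · rw [← h]
    exact (Set.inter_subset_right : e.1 ∩ z.1 ⊆ z.1)

theorem IsMember.notMem_bot_iff (hM : 𝓜.IsMember M) {f : E} (hf : f ∈ M.E) :
    f ∉ (⊥ : 𝓜.Flat).1 ↔ {f} ∈ 𝓜.indep := by
  rw [hM.bot_eq, ← Matroid.isLoop_iff, Matroid.not_isLoop_iff hf, ← Matroid.indep_singleton, hM.2]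
  exact and_iff_left (Set.singleton_subset_iff.2 hf)

variable [Fintype E]

/-- Every cover raises the matroid rank by exactly one, starting from rank 0 at the loops. -/
theorem IsMember.height_eq (hM : 𝓜.IsMember M) {x : 𝓜.Flat} (hx : M.IsFlat x.1) :
    Order.height x = M.eRk x.1 := by
  induction hn : rk x using Nat.strong_induction_on generalizing x with
  | _ n ih =>
  subst hn
  apply le_antisymm
  · rw [Order.height_eq_iSup_lt_height]
    refine iSup₂_le fun y hy => ?_
    rw [ih _ (GeometricBouquet.rk_lt hy) (hM.isFlat_of_le hx hy.le) rfl]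
    obtain ⟨z, hyz, hzx⟩ := GeometricBouquet.exists_covBy_le hy
    rw [← hM.eRk_covBy (hM.isFlat_of_le hx hzx) hyz]
    exact M.eRk_mono hzx
  · by_cases hb : x = ⊥
    · subst hb
      rw [hM.bot_eq, M.eRk_loops]
      exact zero_le
    · obtain ⟨z, -, hzx⟩ := GeometricBouquet.exists_le_covBy (bot_lt_iff_ne_bot.2 hb)
      rw [hM.eRk_covBy hx hzx, ← ih _ (GeometricBouquet.rk_lt hzx.lt) (hM.isFlat_of_le hx hzx.le) rfl]
      exact Order.height_add_one_le hzx.lt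

/-- The flats of a bouquet of matroids form a bouquet of geometric lattices. -/
instance : GeometricBouquet 𝓜.Flat where
  exists_isGLB x y := by
    refine ⟨⟨x.1 ∩ y.1, isFlat_inter x y⟩, ?_, ?_⟩
    · rintro _ (h | h) <;> rw [h]
      · exact (Set.inter_subset_left : x.1 ∩ y.1 ⊆ x.1)
      · exact (Set.inter_subset_right : x.1 ∩ y.1 ⊆ y.1)
    · intro t ht
      exact Set.subset_inter (ht (Set.mem_insert _ _)) (ht (Set.mem_insert_of_mem _ rfl))
  rk_covBy {x y} h := by
    obtain ⟨M, hM, hy⟩ := exists_isMember_isFlat y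
    have h1 := hM.eRk_covBy hy h
    rw [← hM.height_eq hy, ← hM.height_eq (hM.isFlat_of_le hy h.le), ← GeometricBouquet.coe_rk,
      ← GeometricBouquet.coe_rk] at h1
    exact_mod_cast h1
  exists_cover {e x y} he hex hyx hey := by
    obtain ⟨M, hM, hx⟩ := exists_isMember_isFlat x
    obtain ⟨f, hfe, hfy⟩ := Set.not_subset.1 hey
    have hfM : f ∈ M.E := hx.subset_ground (hex hfe)
    exact ⟨hM.closureFlat (insert f y.1),
      hM.covBy_closureFlat_insert (hM.isFlat_of_le hx hyx) hfM hfy,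
      hM.closureFlat_insert_le hx hyx (hex hfe),
      atom_le he hfe (hM.mem_closureFlat_insert hfM) fun h => hfy ((bot_le : ⊥ ≤ y) h)⟩
  exists_atom {x y} hyx := by
    obtain ⟨M, hM, hx⟩ := exists_isMember_isFlat x
    obtain ⟨f, hfx, hfy⟩ := Set.not_subset.1 hyx.not_ge
    obtain ⟨e, he, hex, hfe⟩ := exists_atom_mem hM hx hfx fun h => hfy ((bot_le : ⊥ ≤ y) h)
    exact ⟨e, he, hex, fun h => hfy (h hfe)⟩

open Classical in
-- Each nonloop of `x` lies in exactly one atom, which is below `x`, and loops weigh nothing.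
theorem atomWeight_weight (x : 𝓜.Flat) :
    GeometricBouquet.atomWeight 𝓜.weight x = 𝓜.weight x := by
  obtain ⟨M, hM, hx⟩ := exists_isMember_isFlat x
  unfold GeometricBouquet.atomWeight weight
  trans ∑ a : {a : 𝓜.Flat // IsAtom a}, ∑ f : E,
    if a.1 ≤ x ∧ f ∈ a.1.1 then 𝓜.elementWeight f else 0
  · refine Finset.sum_congr rfl fun a _ => ?_
    by_cases h : a.1 ≤ x
    · simp [h, Finset.sum_filter]
    · simp [h]
  rw [Finset.sum_comm, Finset.sum_filter]
  refine Finset.sum_congr rfl fun f _ => ?_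
  by_cases hfx : f ∈ x.1
  · have hfM := hx.subset_ground hfx
    rw [if_pos hfx]
    by_cases hf : {f} ∈ 𝓜.indep
    · have hfb := (hM.notMem_bot_iff hfM).2 hf
      obtain ⟨e, he, hex, hfe⟩ := exists_atom_mem hM hx hfx hfb
      rw [Finset.sum_eq_single_of_mem ⟨e, he⟩ (mem_univ _), if_pos ⟨hex, hfe⟩]
      rintro ⟨a, ha⟩ - hae
      refine if_neg fun h => hae (Subtype.ext ?_)
      exact le_antisymm (atom_le ha h.2 hfe hfb) (atom_le he hfe h.2 hfb)
    · simp [elementWeight, hf]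
  · rw [if_neg hfx]
    exact Finset.sum_eq_zero fun a _ => if_neg fun h => hfx (h.1 h.2)

theorem weight_ne_zero {x : 𝓜.Flat} (hx : x ≠ ⊥) : 𝓜.weight x ≠ 0 := by
  classical
  intro h0
  obtain ⟨M, hM, hxM⟩ := exists_isMember_isFlat x
  obtain ⟨f, hfx, hfb⟩ := Set.not_subset.1 (bot_lt_iff_ne_bot.2 hx).not_ge
  have hf := (hM.notMem_bot_iff (hxM.subset_ground hfx)).1 hfb
  -- At the all-ones point the weight counts the nonloops of `x`.
  have h1 := congrArg (MvPolynomial.eval fun _ : E => (1 : ℤ)) h0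
  unfold weight at h1
  rw [map_sum, map_zero, Finset.sum_eq_zero_iff_of_nonneg] at h1
  · have := h1 f (by simpa using hfx)
    simp [elementWeight, hf] at this
  · intro e _
    unfold elementWeight
    split_ifs <;> simp

end MatroidBouquet

theorem MvPolynomial.mul_self_eq_one_of_isUnit {σ : Type*} {u : MvPolynomial σ ℤ} (h : IsUnit u) :
    u * u = 1 := by
  obtain ⟨r, hr, rfl⟩ := MvPolynomial.isUnit_iff_eq_C_of_isReduced.1 h
  rw [← map_mul, Int.isUnit_mul_self hr, map_one]

theorem mainTheorem4 {E : Type*} [Fintype E] (𝓜 : MatroidBouquet E)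
    (l : 𝓜.Flat → 𝓜.Flat) (hl : IsAtomLabeling l) :
    (∀ K : 𝓜.Flat, 0 ≤ cumulatedRho K) ∧
    ((𝓜.flagMatrix l).det = ∏ K : 𝓜.Flat, 𝓜.weight K ^ (cumulatedRho K).toNat ∨
      (𝓜.flagMatrix l).det = -∏ K : 𝓜.Flat, 𝓜.weight K ^ (cumulatedRho K).toNat) := by
  -- Rows and columns come from the same family of vectors, so the sign is always plus.
  refine ⟨GeometricBouquet.cumulatedRho_nonneg hl, Or.inl ?_⟩
  have h := GeometricBouquet.det_chainMatrix hl (fun _ => MvPolynomial.mul_self_eq_one_of_isUnit)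
    𝓜.weight fun y hy => by
      rw [MatroidBouquet.atomWeight_weight]
      exact MatroidBouquet.weight_ne_zero hy
  simp only [MatroidBouquet.atomWeight_weight] at h
  exact h
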